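/- All graphs are finite and simple. An incidence of a graph $G$ is a pair $(u,e)$ where $e$ is an edge of $G$ and $u$ is an endpoint of $e$; two distinct incidences $(u,e)$ and $(v,f)$ are adjacent if $u=v$, or $e=f$, or $uv=e$, or $uv=f$. An incidence $6$-list assignment $L$ gives each incidence a set of $6$ colors; an incidence $L$-coloring chooses $\varphi(u,e)\in L(u,e)$ for every incidence so that adjacent incidences get distinct colors, and $G$ is incidence $L$-choosable if an incidence $L$-coloring exists. An edge $e=uv$ is freely $L$-choosable if for any two distinct colors $c_1\in L(u,e)$, $c_2\in L(v,e)$ there is an incidence $L$-coloring $\varphi$ with $\varphi(u,e)=c_1$ and $\varphi(v,e)=c_2$. A graph is almost cubic if all its vertices, except at most one, have degree three. A $(1,2)$-decomposition of $G$ is a bipartition $(E_1,E_2)$ of $E(G)$ such that $E_1$ induces a $1$-factor (perfect matching) of $G$ and $E_2$ induces a $2$-regular graph $G[E_2]$ (not necessarily spanning). Let $\mathcal C(G;E_2)$ be the graph whose vertices are the cycles (the components) of $G[E_2]$, two of them being adjacent if and only if $G$ has an edge between them. Let $\mathcal T$ be a DFS-tree of $\mathcal C(G;E_2)$ with DFS-ordering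 $C^{(0)},C^{(1)},\dots,C^{(m)}$; that is, for each $i\ge 1$ the parent of $C^{(i)}$ is the vertex $C^{(j)}$ with the largest $j<i$ that has a neighbor outside $\{C^{(0)},\dots,C^{(i-1)}\}$, $C^{(i)}$ is adjacent to its parent in $\mathcal C(G;E_2)$, and the edges of $\mathcal T$ are the edges from the $C^{(i)}$ with $i\geq 1$ to their parents. The cycle $C^{(0)}$ is the root cycle. A cycle-tree $G_{\mathcal T}$ with the structure $\mathcal T$ is a subgraph of $G$ obtained from $G[E_2]$ by adding, for each edge $CC'$ of $\mathcal T$, exactly one edge of $G$ between $C$ and $C'$. A cycle $C^{(i)}$ is a pendent cycle of $G_{\mathcal T}$ if it contains exactly one cut vertex of $G_{\mathcal T}$. **Lemma.** Let $G$ be an almost cubic connected graph with a $(1,2)$-decomposition $(E_1,E_2)$, let $L$ be an incidence $6$-list assignment of $G$, let $\mathcal T$ be a DFS-tree of $\mathcal C(G;E_2)$ with DFS-ordering $C^{(0)},\dots,C^{(m)}$, and let $G_{\mathcal T}$ be a cycle-tree with the structure $\mathcal T$. Then $G$ is incidence $L$-choosable. Moreover, an edge $e^*$ of $G$ that has an endpoint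 on the root cycle $C^{(0)}$ is freely $L$-choosable if one of the following holds: (i) $C^{(0)}$ is a cycle $x_0x_1\dots x_{n-1}$ with $n\ge 7$ such that $e^*=x_0x_1$ and $x_2x_4,\ x_3x_5,\ x_1x_6\in E(G)$; (ii) $e^*$ is a pendent edge of $G$ (one of its endpoints has degree $1$); (iii) $e^*$ is not a cut edge of $G_{\mathcal T}$, and there is a non-root pendent $6$-cycle $x_1x_2\dots x_6$ of $G_{\mathcal T}$ among $C^{(1)},\dots,C^{(m)}$ such that $x_2x_4,\ x_3x_5\in E(G)$ and $x_1$ is an endpoint of $e^*$. -/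

import Mathlib

namespace IncidenceChoosability

/-- An incidence of `G`: a pair `(u, e)` where `e` is an edge of `G` and `u` is an endpoint of `e`. -/
def Incidence {V : Type*} (G : SimpleGraph V) : Type _ :=
  {p : V × Sym2 V // p.2 ∈ G.edgeSet ∧ p.1 ∈ p.2}

namespace Incidence

/-- The vertex `u` of the incidence `(u, e)`. -/
def vertex {V : Type*} {G : SimpleGraph V} (i : Incidence G) : V := i.1.1

/-- The edge `e` of the incidence `(u, e)`. -/
def edge {V : Type*} {G : SimpleGraph V} (i : Incidence G) : Sym2 V := i.1.2

/-- Two (distinct) incidences `(u, e)` and `(v, f)` are adjacent if `u = v`, or `e = f`, or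
`uv = e`, or `uv = f`. -/
def Adjacent {V : Type*} {G : SimpleGraph V} (i j : Incidence G) : Prop :=
  i ≠ j ∧ (i.vertex = j.vertex ∨ i.edge = j.edge ∨
    s(i.vertex, j.vertex) = i.edge ∨ s(i.vertex, j.vertex) = j.edge)

end Incidence

/-- `φ` is an incidence `L`-coloring: each incidence gets a color of its list, and adjacent
incidences get distinct colors. -/
def IsListColoring {V α : Type*} {G : SimpleGraph V} (L : Incidence G → Finset α)
    (φ : Incidence G → α) : Prop :=
  (∀ i, φ i ∈ L i) ∧ ∀ i j, i.Adjacent j → φ i ≠ φ j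

/-- `G` is incidence `L`-choosable. -/
def IsChoosable {V α : Type*} {G : SimpleGraph V} (L : Incidence G → Finset α) : Prop :=
  ∃ φ : Incidence G → α, IsListColoring L φ

/-- The edge `e` is freely `L`-choosable: any two distinct colors chosen from the lists of the two
incidences `i`, `j` on `e` extend to an incidence `L`-coloring of `G`. -/
def IsFreelyChoosable {V α : Type*} {G : SimpleGraph V} (L : Incidence G → Finset α)
    (e : Sym2 V) : Prop :=
  ∀ i j : Incidence G, i ≠ j → i.edge = e → j.edge = e →
    ∀ c₁ ∈ L i, ∀ c₂ ∈ L j, c₁ ≠ c₂ →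
      ∃ φ : Incidence G → α, IsListColoring L φ ∧ φ i = c₁ ∧ φ j = c₂

/-- Every vertex has degree three, except at most one vertex. -/
def IsAlmostCubic {V : Type*} (G : SimpleGraph V) [G.LocallyFinite] : Prop :=
  ∀ u v : V, G.degree u ≠ 3 → G.degree v ≠ 3 → u = v

/-- The edge `e` of `G` is pendent: one of its endpoints has degree one. -/
def IsPendentEdge {V : Type*} (G : SimpleGraph V) [G.LocallyFinite] (e : Sym2 V) : Prop :=
  e ∈ G.edgeSet ∧ ∃ v ∈ e, G.degree v = 1

/-- The subgraph `G[E]` of `G` induced by a set `E` of edges: its edges are those of `E`, its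
vertices are the endpoints of these edges. -/
def edgeInduced {V : Type*} (G : SimpleGraph V) (E : Set (Sym2 V)) : G.Subgraph where
  verts := {u | ∃ v, G.Adj u v ∧ s(u, v) ∈ E}
  Adj u v := G.Adj u v ∧ s(u, v) ∈ E
  adj_sub h := h.1
  edge_vert h := ⟨_, h⟩
  symm := ⟨fun _ _ h => ⟨h.1.symm, Sym2.eq_swap ▸ h.2⟩⟩

/-- A (1,2)-decomposition: a bipartition `(E₁, E₂)` of the edge set of `G` such that `E₁` induces
a 1-factor (perfect matching) of `G` and `E₂` induces a 2-regular graph. The 2-regular graph need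
not span `G`. -/
structure IsOneTwoDecomposition {V : Type*} (G : SimpleGraph V) (E₁ E₂ : Set (Sym2 V)) :
    Prop where
  union_eq : E₁ ∪ E₂ = G.edgeSet
  disjoint : Disjoint E₁ E₂
  oneFactor : (edgeInduced G E₁).IsPerfectMatching
  twoRegular : ∀ v ∈ (edgeInduced G E₂).verts, ((edgeInduced G E₂).neighborSet v).ncard = 2

/-- The cycles of the 2-regular graph `G[E₂]`, i.e. its connected components. -/
abbrev CycleOf {V : Type*} (G : SimpleGraph V) (E₂ : Set (Sym2 V)) : Type _ :=
  (edgeInduced G E₂).coe.ConnectedComponent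

/-- The set of vertices of `G` on the cycle `C`. -/
def CycleOf.vertexSet {V : Type*} {G : SimpleGraph V} {E₂ : Set (Sym2 V)}
    (C : CycleOf G E₂) : Set V :=
  Subtype.val '' C.supp

/-- `C` is the `n`-cycle `x₀ x₁ … xₙ₋₁` (indices modulo `n`). -/
def IsCycleLabelling {V : Type*} {G : SimpleGraph V} {E₂ : Set (Sym2 V)} (C : CycleOf G E₂)
    (n : ℕ) (x : ZMod n → V) : Prop :=
  Function.Injective x ∧ Set.range x = C.vertexSet ∧
    ∀ i, (edgeInduced G E₂).Adj (x i) (x (i + 1))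

/-- The graph `𝒞(G; E₂)`: its vertices are the cycles of `G[E₂]`, and two cycles are adjacent if
and only if `G` has an edge between them. -/
def cycleGraph {V : Type*} (G : SimpleGraph V) (E₂ : Set (Sym2 V)) :
    SimpleGraph (CycleOf G E₂) where
  Adj C D := C ≠ D ∧ ∃ u ∈ C.vertexSet, ∃ v ∈ D.vertexSet, G.Adj u v
  symm := ⟨fun _ _ h => ⟨h.1.symm, by
    obtain ⟨u, hu, v, hv, huv⟩ := h.2
    exact ⟨v, hv, u, hu, huv.symm⟩⟩⟩
  loopless := ⟨fun _ h => h.1 rfl⟩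

/-- `T` is a DFS-tree of `H` with DFS-ordering `c 0, c 1, …, c m` (so `c 0` is the root). At each
step of the depth-first search the next vertex `c (i + 1)` is a neighbor of the most recently
visited vertex that still has an unvisited neighbor; this vertex `c (parent i)` becomes the parent
of `c (i + 1)`, and `T` consists of the edges between parents and children. -/
def IsDFSTree {W : Type*} (H T : SimpleGraph W) {m : ℕ} (c : Fin (m + 1) ≃ W) : Prop :=
  ∃ parent : Fin m → Fin (m + 1),
    (∀ i : Fin m,
      parent i < i.succ ∧ H.Adj (c (parent i)) (c i.succ) ∧
      ∀ k l : Fin (m + 1), parent i < k → k < i.succ → H.Adj (c k) (c l) → l < i.succ) ∧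
    ∀ a b : W, T.Adj a b ↔ ∃ i : Fin m, s(a, b) = s(c (parent i), c i.succ)

/-- `S` is a cycle-tree `G_T` with the structure `T`, for a spanning tree `T` of `𝒞(G; E₂)`: it is
obtained from `G[E₂]` by adding, for each edge `CD` of `T`, exactly one edge of `G` between the
cycles `C` and `D`, and nothing else. -/
structure IsCycleTreeWithStructure {V : Type*} {G : SimpleGraph V} {E₂ : Set (Sym2 V)}
    (T : SimpleGraph (CycleOf G E₂)) (S : G.Subgraph) : Prop where
  verts_eq : S.verts = (edgeInduced G E₂).verts
  adj_same : ∀ C : CycleOf G E₂, ∀ u ∈ C.vertexSet, ∀ v ∈ C.vertexSet,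
    (S.Adj u v ↔ (edgeInduced G E₂).Adj u v)
  adj_joined : ∀ C D : CycleOf G E₂, T.Adj C D →
    ∃! p : V × V, p.1 ∈ C.vertexSet ∧ p.2 ∈ D.vertexSet ∧ S.Adj p.1 p.2
  adj_not_joined : ∀ C D : CycleOf G E₂, C ≠ D → ¬ T.Adj C D →
    ∀ u ∈ C.vertexSet, ∀ v ∈ D.vertexSet, ¬ S.Adj u v

/-- `e` is a cut edge (bridge) of the subgraph `S`. -/
def IsCutEdge {V : Type*} {G : SimpleGraph V} (S : G.Subgraph) (e : Sym2 V) : Prop :=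
  e ∈ S.edgeSet ∧ S.spanningCoe.IsBridge e

/-- `v` is a cut vertex of the connected subgraph `S`. -/
def IsCutVertex {V : Type*} {G : SimpleGraph V} (S : G.Subgraph) (v : V) : Prop :=
  v ∈ S.verts ∧ ¬ (S.deleteVerts {v}).Preconnected

/-- The cycle `C` of a cycle-tree `S` (`C` is one of its blocks) is pendent, i.e. it is a pendent
block: it contains exactly one cut vertex of `S`. -/
def IsPendentCycle {V : Type*} {G : SimpleGraph V} {E₂ : Set (Sym2 V)} (S : G.Subgraph)
    (C : CycleOf G E₂) : Prop :=
  ∃! v : V, v ∈ C.vertexSet ∧ IsCutVertex S v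

end IncidenceChoosability

/-! Write the incidence of `u` with `uv` as the arc `(u, v)`, so that an incidence coloring is a
vertex coloring of `arcGraph`. In a graph of maximum degree three an arc conflicts with at most 2 +
3 + 2 = 7 others, so lists of six colors are at most one short of the degree. `SlackColorable`
isolates this situation: every list may be one smaller than the degree, with extra room `g` at
chosen arcs.

An uncolored arc may be colored without harm while two of its neighbors are uncolored: its list is
nonempty, and no other arc loses slack. Read backwards, slack-colorability of a core containing both
arcs of an edge spreads to every edge connected to it (`SlackColorable.union_arcs`). It therefore
suffices to find one slack-colorable core.

A triangle is a core, because its conflict graph is `K_{2,2,2}`, which is 3-choosable. In a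
triangle-free graph the core is a cycle of vertices of degree three together with third edges at
four of its vertices. Coloring the third edges at both ends of a cycle edge either gains one at both
arcs of that edge, or the lists are so rigid that another partial coloring finishes at once
(`exists_gain_or_rigid`). Gains at two suitable edges of the cycle suffice to color it
(`slackColorable_cycle`).

For free choosability, color the two arcs of `e` first; a core must then be found in `G - e`. In (i)
and (iii) the triangle `x₂x₃x₄` survives and `G - e` is connected. In (ii) the vertices off the
pendent edge have degree three and contain a cycle. Choosability of `G` itself is the cubic case of
the core argument, or follows from (ii) when a vertex of degree one exists. -/

namespace IncidenceChoosability

/-! ### List coloring with lists one short of the degree -/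

section ListColoring

open scoped Classical in
/-- The number of `K`-neighbors of `a` in `U`. -/
noncomputable def degIn {ι : Type*} (K : SimpleGraph ι) (U : Finset ι) (a : ι) : ℕ :=
  (U.filter (K.Adj a)).card

/-- The subgraph of `K` induced by `U` is colorable from the lists `A`. -/
def ListColorable {ι α : Type*} (K : SimpleGraph ι) (U : Finset ι) (A : ι → Finset α) : Prop :=
  ∃ φ : ι → α, (∀ a ∈ U, φ a ∈ A a) ∧ ∀ a ∈ U, ∀ b ∈ U, K.Adj a b → φ a ≠ φ b

open scoped Classical in
/-- The lists that remain after `a` has received the color `c`. -/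
noncomputable def reduceLists {ι α : Type*} (K : SimpleGraph ι) (A : ι → Finset α) (a : ι) (c : α) :
    ι → Finset α :=
  fun b => if K.Adj a b then (A b).erase c else A b

/-- Every list assignment whose lists fall short of the degree by at most one, and exceed this
bound by the prescribed gain `g`, admits a coloring. -/
def SlackColorable {ι : Type*} (α : Type*) (K : SimpleGraph ι) (g : ι → ℕ) (U : Finset ι) : Prop :=
  ∀ A : ι → Finset α, (∀ b ∈ U, degIn K U b + g b ≤ (A b).card + 1) → ListColorable K U A

variable {ι α : Type*} {K : SimpleGraph ι}

theorem ListColorable.of_erase [DecidableEq ι] {U : Finset ι} {A : ι → Finset α} {a : ι} {c : α} (hc : c ∈ A a)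
    (h : ListColorable K (U.erase a) (reduceLists K A a c)) : ListColorable K U A := by
  classical
  obtain ⟨φ, h1, h2⟩ := h
  have key : ∀ b ∈ U, b ≠ a → φ b ∈ A b ∧ (K.Adj a b → φ b ≠ c) := by
    intro b hb hba
    have := h1 b (Finset.mem_erase.2 ⟨hba, hb⟩)
    unfold reduceLists at this
    split_ifs at this with hab
    · exact ⟨Finset.mem_of_mem_erase this, fun _ => Finset.ne_of_mem_erase this⟩
    · exact ⟨this, fun h => absurd h hab⟩
  refine ⟨Function.update φ a c, fun b hb => ?_, fun b hb d hd hbd => ?_⟩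
  · by_cases hba : b = a
    · subst hba; simpa using hc
    · rw [Function.update_of_ne hba]; exact (key b hb hba).1
  · by_cases hba : b = a
    · subst hba
      rw [Function.update_self, Function.update_of_ne hbd.ne']
      exact ((key d hd hbd.ne').2 hbd).symm
    · by_cases hda : d = a
      · subst hda
        rw [Function.update_self, Function.update_of_ne hba]
        exact (key b hb hba).2 hbd.symm
      · rw [Function.update_of_ne hba, Function.update_of_ne hda]
        exact h2 b (Finset.mem_erase.2 ⟨hba, hb⟩) d (Finset.mem_erase.2 ⟨hda, hd⟩) hbd

theorem ListColorable.mono {U : Finset ι} {A B : ι → Finset α} (hAB : ∀ a ∈ U, A a ⊆ B a)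
    (h : ListColorable K U A) : ListColorable K U B := by
  obtain ⟨φ, h1, h2⟩ := h
  exact ⟨φ, fun a ha => hAB a ha (h1 a ha), h2⟩

theorem reduceLists_of_adj {A : ι → Finset α} {a b : ι} {c : α} [DecidableEq α] (h : K.Adj a b) :
    reduceLists K A a c b = (A b).erase c := by
  unfold reduceLists; rw [if_pos h]; congr!

theorem reduceLists_of_not_adj {A : ι → Finset α} {a b : ι} {c : α} (h : ¬ K.Adj a b) :
    reduceLists K A a c b = A b := by
  unfold reduceLists; rw [if_neg h]

theorem degIn_erase_of_adj [DecidableEq ι] {U : Finset ι} {a b : ι} (ha : a ∈ U) (h : K.Adj a b) :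
    degIn K (U.erase a) b + 1 = degIn K U b := by
  classical
  unfold degIn
  rw [← Finset.card_erase_add_one (a := a) (s := U.filter (K.Adj b))
    (Finset.mem_filter.2 ⟨ha, h.symm⟩)]
  congr 2
  ext x; simp; tauto

theorem degIn_erase_of_not_adj [DecidableEq ι] {U : Finset ι} {a b : ι} (h : ¬ K.Adj a b) :
    degIn K (U.erase a) b = degIn K U b := by
  classical
  unfold degIn
  congr 1
  ext x; simp only [Finset.mem_filter, Finset.mem_erase]
  constructor
  · rintro ⟨⟨_, h2⟩, h3⟩; exact ⟨h2, h3⟩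
  · rintro ⟨h2, h3⟩; exact ⟨⟨fun e => h (e ▸ h3.symm), h2⟩, h3⟩

theorem degIn_mono {U U' : Finset ι} (h : U ⊆ U') (a : ι) : degIn K U a ≤ degIn K U' a := by
  classical
  exact Finset.card_le_card (Finset.filter_subset_filter _ h)

/-- Coloring `a` keeps the slack of every other element. -/
theorem slack_reduceLists [DecidableEq ι] {U : Finset ι} {A : ι → Finset α} {a b : ι} {c : α}
    {k : ℕ} (ha : a ∈ U) (h : degIn K U b + k ≤ (A b).card + 1) :
    degIn K (U.erase a) b + k ≤ (reduceLists K A a c b).card + 1 := by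
  classical
  by_cases hab : K.Adj a b
  · rw [reduceLists_of_adj hab]
    have h1 := degIn_erase_of_adj ha hab
    have h2 := Finset.pred_card_le_card_erase (s := A b) (a := c)
    omega
  · rw [reduceLists_of_not_adj hab, degIn_erase_of_not_adj hab]; exact h

/-- Coloring `a` by a color missing from the list of `b` gains one at `b`. -/
theorem slack_reduceLists_of_notMem [DecidableEq ι] {U : Finset ι} {A : ι → Finset α} {a b : ι}
    {c : α} {k : ℕ} (ha : a ∈ U) (hab : K.Adj a b) (hc : c ∉ A b)
    (h : degIn K U b + k ≤ (A b).card + 1) :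
    degIn K (U.erase a) b + (k + 1) ≤ (reduceLists K A a c b).card + 1 := by
  classical
  rw [reduceLists_of_adj hab, Finset.erase_eq_of_notMem hc]
  have h1 := degIn_erase_of_adj ha hab
  omega

/-- The new element `a` is colored first: two units of degree or gain make its list nonempty, and
each neighbor loses at most one color along with one uncolored neighbor. Sets are thus built in the
reverse of the coloring order. -/
theorem SlackColorable.insert_of_two_le [DecidableEq ι] {g : ι → ℕ} {U : Finset ι} {a : ι} (ha : a ∉ U)
    (hd : 2 ≤ degIn K U a + g a) (h : SlackColorable α K g U) :
    SlackColorable α K g (insert a U) := by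
  intro A hA
  have h1 := hA a (Finset.mem_insert_self a U)
  have h2 := degIn_mono (K := K) (Finset.subset_insert a U) a
  obtain ⟨c, hc⟩ : (A a).Nonempty := by rw [← Finset.card_pos]; omega
  refine ListColorable.of_erase hc ?_
  have e : (insert a U : Finset ι).erase a = U := Finset.erase_insert ha
  rw [e]
  apply h
  intro b hb
  have := slack_reduceLists (c := c) (Finset.mem_insert_self a U)
    (hA b (Finset.mem_insert_of_mem hb))
  rwa [e] at this

theorem SlackColorable.empty [Nonempty α] (g : ι → ℕ) : SlackColorable α K g ∅ :=
  fun _ _ => ⟨fun _ => Classical.arbitrary α, by simp, by simp⟩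

theorem two_le_degIn {U : Finset ι} {a b c : ι} (hb : b ∈ U) (hc : c ∈ U) (hbc : b ≠ c)
    (hab : K.Adj a b) (hac : K.Adj a c) : 2 ≤ degIn K U a := by
  classical
  unfold degIn
  rw [← Finset.card_pair hbc]
  apply Finset.card_le_card
  intro x hx
  simp only [Finset.mem_insert, Finset.mem_singleton] at hx
  rcases hx with rfl | rfl <;> simp [*]

theorem one_le_degIn {U : Finset ι} {a b : ι} (hb : b ∈ U) (hab : K.Adj a b) :
    1 ≤ degIn K U a := by
  classical
  unfold degIn
  exact Finset.card_pos.2 ⟨b, by simp [*]⟩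

theorem card_le_degIn {U : Finset ι} {a : ι} (T : Finset ι)
    (hT : ∀ t ∈ T, t ∈ U ∧ K.Adj a t) : T.card ≤ degIn K U a := by
  classical
  exact Finset.card_le_card fun t ht => Finset.mem_filter.2 (hT t ht)

/-- A pair of nonadjacent neighbors of `v` can be colored so that `v` gains one. -/
theorem SlackColorable.of_pair [DecidableEq ι] {g : ι → ℕ} {U : Finset ι} {u u' v : ι}
    (hu : u ∈ U) (hu' : u' ∈ U) (huu : u ≠ u') (hn : ¬ K.Adj u u') (huv : K.Adj u v)
    (huv' : K.Adj u' v) (h1 : 1 < degIn K U u + g u) (h1' : 1 < degIn K U u' + g u')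
    (hs : degIn K U v + g v + 2 ≤ (degIn K U u + g u) + (degIn K U u' + g u'))
    (h : SlackColorable α K (fun b => g b + if b = v then 1 else 0) ((U.erase u).erase u')) :
    SlackColorable α K g U := by
  classical
  intro A hA
  have hAu := hA u hu
  have hAu' := hA u' hu'
  have hu'' : u' ∈ U.erase u := Finset.mem_erase.2 ⟨huu.symm, hu'⟩
  suffices ∃ c ∈ A u, ∃ c' ∈ A u', (v ∈ U → degIn K ((U.erase u).erase u') v + (g v + 1) ≤
      (reduceLists K (reduceLists K A u c) u' c' v).card + 1) by
    obtain ⟨c, hc, c', hc', hv⟩ := this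
    refine ListColorable.of_erase hc (ListColorable.of_erase (a := u') (c := c') ?_ ?_)
    · rwa [reduceLists_of_not_adj hn]
    · apply h
      intro b hb
      have hbU : b ∈ U := Finset.mem_of_mem_erase (Finset.mem_of_mem_erase hb)
      by_cases hbv : b = v
      · subst hbv; simpa using hv hbU
      · simpa [hbv] using slack_reduceLists hu'' (slack_reduceLists hu (hA b hbU))
  by_cases hvU : v ∈ U; swap
  · obtain ⟨c, hc⟩ : (A u).Nonempty := by rw [← Finset.card_pos]; omega
    obtain ⟨c', hc'⟩ : (A u').Nonempty := by rw [← Finset.card_pos]; omega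
    exact ⟨c, hc, c', hc', fun h => absurd h hvU⟩
  have hAv := hA v hvU
  -- `v` gains if `u` and `u'` share a color, or if either receives a color absent from the list of
  -- `v`.
  by_cases hint : ∃ c, c ∈ A u ∧ c ∈ A u'
  · obtain ⟨c, hc, hc'⟩ := hint
    refine ⟨c, hc, c, hc', fun _ => ?_⟩
    apply slack_reduceLists_of_notMem hu'' huv' _ (slack_reduceLists hu hAv)
    rw [reduceLists_of_adj huv]
    exact Finset.notMem_erase _ _
  by_cases hout : ∃ c ∈ A u, c ∉ A v
  · obtain ⟨c, hc, hcv⟩ := hout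
    obtain ⟨c', hc'⟩ : (A u').Nonempty := by rw [← Finset.card_pos]; omega
    exact ⟨c, hc, c', hc', fun _ => slack_reduceLists hu''
      (slack_reduceLists_of_notMem hu huv hcv hAv)⟩
  by_cases hout' : ∃ c ∈ A u', c ∉ A v
  · obtain ⟨c', hc', hcv⟩ := hout'
    obtain ⟨c, hc⟩ : (A u).Nonempty := by rw [← Finset.card_pos]; omega
    refine ⟨c, hc, c', hc', fun _ => slack_reduceLists_of_notMem hu'' huv' ?_
      (slack_reduceLists hu hAv)⟩
    rw [reduceLists_of_adj huv]
    exact fun h => hcv (Finset.mem_of_mem_erase h)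
  push Not at hint hout hout'
  obtain ⟨c, hc⟩ : (A u).Nonempty := by rw [← Finset.card_pos]; omega
  obtain ⟨c', hc'⟩ : (A u').Nonempty := by rw [← Finset.card_pos]; omega
  refine ⟨c, hc, c', hc', fun _ => ?_⟩
  -- Otherwise the two lists are disjoint inside `A v`; by `hs` this makes `A v` large enough to
  -- have the gain already.
  have hcard : (A u).card + (A u').card ≤ (A v).card := by
    rw [← Finset.card_union_of_disjoint (Finset.disjoint_left.2 hint)]
    exact Finset.card_le_card (Finset.union_subset hout hout')
  rw [reduceLists_of_adj huv', reduceLists_of_adj huv]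
  have e1 := Finset.pred_card_le_card_erase (s := A v) (a := c)
  have e2 := Finset.pred_card_le_card_erase (s := (A v).erase c) (a := c')
  have e3 := degIn_erase_of_adj hu huv
  have e4 := degIn_erase_of_adj hu'' huv'
  omega

end ListColoring

/-! ### Color choices on two third edges -/

section ColorSets

variable {α : Type*} [DecidableEq α]

/-- If the two lists `O`, `O'` cannot be used to gain at both `Lv` and `Lw`, although some color of
`O` is missing from `Lv`, then the lists have a rigid structure. -/
theorem exists_gain_or_rigid_of_notMem {O I O' I' Lv Lw : Finset α} (hO : 4 ≤ O.card)
    (hI : 2 ≤ I.card) (hO' : 4 ≤ O'.card) (hI' : 2 ≤ I'.card) (hv : Lv.card = 6)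
    (hw : Lw.card = 6) (hdis : Disjoint O O')
    (hN : ∀ o ∈ O, ∀ i ∈ I, ∀ o' ∈ O', ∀ i' ∈ I', o ≠ i → o' ≠ i' →
      (o ∈ Lv ∧ i ∈ Lv ∧ o' ∈ Lv ∧ i ≠ o') ∨ (o ∈ Lw ∧ o' ∈ Lw ∧ i' ∈ Lw ∧ o ≠ i'))
    (hx : ∃ x ∈ O, x ∉ Lv) :
    ∃ r ∈ Lv, ∃ p ∈ Lw, ∃ s ∈ I, ∃ q ∈ O, r ≠ p ∧ r ≠ s ∧ r ≠ q ∧ p ≠ q ∧ s ≠ q ∧ p ≠ s ∧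
      r ∉ O' ∧ p ∉ O' ∧ p ∉ I' := by
  have ex : ∀ {S : Finset α} (t : α), 2 ≤ S.card → ∃ s ∈ S, s ≠ t := by
    intro S t hS
    exact Finset.exists_mem_ne (by omega) t
  obtain ⟨o0, ho0, -⟩ : ∃ s ∈ O', s ≠ s ∨ True := by
    obtain ⟨s, hs⟩ : O'.Nonempty := by rw [← Finset.card_pos]; omega
    exact ⟨s, hs, Or.inr trivial⟩
  -- Using `x` gains at `Lv`, so every choice on the other edge must fail to gain at `Lw`.
  have hA : ∀ x ∈ O, x ∉ Lv → x ∈ Lw ∧ x ∉ I' ∧ O' ⊆ Lw := by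
    intro x hx hxv
    obtain ⟨i, hi, hix⟩ := ex x hI
    have h1 : ∀ o' ∈ O', ∀ i' ∈ I', o' ≠ i' → x ∈ Lw ∧ o' ∈ Lw ∧ i' ∈ Lw ∧ x ≠ i' := by
      intro o' ho' i' hi' hne
      rcases hN x hx i hi o' ho' i' hi' hix.symm hne with h | h
      · exact absurd h.1 hxv
      · exact h
    refine ⟨?_, ?_, ?_⟩
    · obtain ⟨i', hi', hne⟩ := ex o0 hI'
      exact (h1 o0 ho0 i' hi' hne.symm).1
    · intro hxI
      obtain ⟨o', ho', hne⟩ := ex x (by omega : 2 ≤ O'.card)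
      exact (h1 o' ho' x hxI hne).2.2.2 rfl
    · intro o' ho'
      obtain ⟨i', hi', hne⟩ := ex o' hI'
      exact (h1 o' ho' i' hi' hne.symm).2.1
  -- Symmetrically, `y` gains at `Lw`, so no choice may gain at `Lv`.
  have hB : ∀ y ∈ O, y ∉ Lw → y ∈ Lv ∧ I ⊆ Lv ∧ O' ⊆ Lv ∧ Disjoint I O' := by
    intro y hy hyw
    have h1 : ∀ i ∈ I, y ≠ i → ∀ o' ∈ O', y ∈ Lv ∧ i ∈ Lv ∧ o' ∈ Lv ∧ i ≠ o' := by
      intro i hi hyi o' ho'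
      obtain ⟨i', hi', hne⟩ := ex o' hI'
      rcases hN y hy i hi o' ho' i' hi' hyi hne.symm with h | h
      · exact h
      · exact absurd h.1 hyw
    obtain ⟨i, hi, hiy⟩ := ex y hI
    have hyv := (h1 i hi hiy.symm o0 ho0).1
    refine ⟨hyv, ?_, fun o' ho' => (h1 i hi hiy.symm o' ho').2.2.1, ?_⟩
    · intro j hj
      by_cases hjy : y = j
      · exact hjy ▸ hyv
      · exact (h1 j hj hjy o0 ho0).2.1
    · rw [Finset.disjoint_left]
      intro j hj hjO
      by_cases hjy : y = j
      · exact Finset.disjoint_left.1 hdis (hjy ▸ hy) hjO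
      · exact (h1 j hj hjy j hjO).2.2.2 rfl
  obtain ⟨x, hxO, hxv⟩ := hx
  have hO'w := (hA x hxO hxv).2.2
  -- A six-element set containing `O'` has room for at most two elements of the disjoint set `O`.
  have card_out : ∀ {S : Finset α}, S.card = 6 → O' ⊆ S → 2 ≤ (O \ S).card := by
    intro S hS hOS
    have h1 : (O ∩ S).card + O'.card ≤ 6 := by
      rw [← Finset.card_union_of_disjoint (hdis.mono_left Finset.inter_subset_left), ← hS]
      exact Finset.card_le_card (Finset.union_subset Finset.inter_subset_right hOS)
    have := Finset.card_sdiff_add_card_inter O S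
    omega
  have hwout := card_out hw hO'w
  obtain ⟨y, hy⟩ : (O \ Lw).Nonempty := by rw [← Finset.card_pos]; omega
  rw [Finset.mem_sdiff] at hy
  obtain ⟨-, hIv, hO'v, h_sub'⟩ := hB y hy.1 hy.2
  have hvout := card_out hv hO'v
  have hLv : O' ∪ O \ Lw = Lv := by
    apply Finset.eq_of_subset_of_card_le
    · refine Finset.union_subset hO'v fun z hz => ?_
      rw [Finset.mem_sdiff] at hz
      exact (hB z hz.1 hz.2).1
    · rw [Finset.card_union_of_disjoint (hdis.symm.mono_right Finset.sdiff_subset)]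
      omega
  have h_sub : I ⊆ O := by
    intro j hj
    have := hIv hj
    rw [← hLv, Finset.mem_union, Finset.mem_sdiff] at this
    rcases this with h | h
    · exact absurd h (Finset.disjoint_left.1 h_sub' hj)
    · exact h.1
  obtain ⟨r, hr, s, hs, hrs⟩ := Finset.one_lt_card.1 (by omega : 1 < I.card)
  obtain ⟨p, hp, q, hq, hpq⟩ := Finset.one_lt_card.1 (by omega : 1 < (O \ Lv).card)
  rw [Finset.mem_sdiff] at hp hq
  have hne : ∀ {z z' : α}, z ∈ I → z' ∉ Lv → z ≠ z' := fun hz hz' h => hz' (h ▸ hIv hz)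
  obtain ⟨hpw, hpI', -⟩ := hA p hp.1 hp.2
  exact ⟨r, hIv hr, p, hpw, s, hs, q, hq.1, hne hr hp.2, hrs, hne hr hq.2, hpq, hne hs hq.2,
    (hne hs hp.2).symm, Finset.disjoint_left.1 hdis (h_sub hr), Finset.disjoint_left.1 hdis hp.1,
    hpI'⟩

/-- `O`, `I` are the lists on one third edge and `O'`, `I'` those on the other. A gain at `Lv`
arises when a color used on a neighbor is missing from `Lv` or occurs twice among its neighbors, and
likewise for `Lw`. If no choice gains at both, the last two alternatives give colors for the middle
edge and one third edge that leave extra room on the other third edge. -/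
theorem exists_gain_or_rigid {O I O' I' Lv Lw : Finset α} (hO : 4 ≤ O.card)
    (hI : 2 ≤ I.card) (hO' : 4 ≤ O'.card) (hI' : 2 ≤ I'.card) (hv : Lv.card = 6)
    (hw : Lw.card = 6) :
    (∃ o ∈ O, ∃ i ∈ I, ∃ o' ∈ O', ∃ i' ∈ I', o ≠ i ∧ o' ≠ i' ∧
      (o ∉ Lv ∨ i ∉ Lv ∨ o' ∉ Lv ∨ i = o' ∨ o = o') ∧
      (o ∉ Lw ∨ o' ∉ Lw ∨ i' ∉ Lw ∨ o = i' ∨ o = o')) ∨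
    (∃ r ∈ Lv, ∃ p ∈ Lw, ∃ s ∈ I, ∃ q ∈ O, r ≠ p ∧ r ≠ s ∧ r ≠ q ∧ p ≠ q ∧ s ≠ q ∧ p ≠ s ∧
      r ∉ O' ∧ p ∉ O' ∧ p ∉ I') ∨
    (∃ r ∈ Lw, ∃ p ∈ Lv, ∃ s ∈ I', ∃ q ∈ O', r ≠ p ∧ r ≠ s ∧ r ≠ q ∧ p ≠ q ∧ s ≠ q ∧ p ≠ s ∧
      r ∉ O ∧ p ∉ O ∧ p ∉ I) := by
  rw [or_iff_not_imp_left]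
  intro hG
  have hN : ∀ o ∈ O, ∀ i ∈ I, ∀ o' ∈ O', ∀ i' ∈ I', o ≠ i → o' ≠ i' →
      (o ∈ Lv ∧ i ∈ Lv ∧ o' ∈ Lv ∧ i ≠ o' ∧ o ≠ o') ∨
      (o ∈ Lw ∧ o' ∈ Lw ∧ i' ∈ Lw ∧ o ≠ i' ∧ o ≠ o') := by
    intro o ho i hi o' ho' i' hi' h1 h2
    by_contra hcon
    exact hG ⟨o, ho, i, hi, o', ho', i', hi', h1, h2, by tauto, by tauto⟩
  have ex : ∀ {S : Finset α} (t : α), 2 ≤ S.card → ∃ s ∈ S, s ≠ t :=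
    fun t hS => Finset.exists_mem_ne (by omega) t
  have hdis : Disjoint O O' := by
    rw [Finset.disjoint_left]
    intro t ht ht'
    obtain ⟨i, hi, hit⟩ := ex t hI
    obtain ⟨i', hi', hit'⟩ := ex t hI'
    have := hN t ht i hi t ht' i' hi' hit.symm hit'.symm
    tauto
  by_cases hx : ∃ x ∈ O, x ∉ Lv
  · left
    refine exists_gain_or_rigid_of_notMem hO hI hO' hI' hv hw hdis ?_ hx
    intro o ho i hi o' ho' i' hi' h1 h2
    have := hN o ho i hi o' ho' i' hi' h1 h2
    tauto
  by_cases hy : ∃ y ∈ O', y ∉ Lw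
  · right
    refine exists_gain_or_rigid_of_notMem hO' hI' hO hI hw hv hdis.symm ?_ hy
    intro o' ho' i' hi' o ho i hi h1 h2
    have := hN o ho i hi o' ho' i' hi' h2 h1
    tauto
  exfalso
  push Not at hx hy
  -- The at least eight colors of `O ∪ O'` do not fit into a list of six. With `O ⊆ Lv` and `O' ⊆
  -- Lw`, this produces a color of `O'` gaining at `Lv` and one of `O` gaining at `Lw`.
  have out : ∀ {S T : Finset α}, S.card = 6 → T ⊆ S → T ⊆ O ∪ O' → 4 ≤ T.card →
      ∃ z ∈ O ∪ O', z ∉ S := by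
    intro S T hS _ _ _
    by_contra hcon
    push Not at hcon
    have := Finset.card_le_card (show O ∪ O' ⊆ S from hcon)
    rw [Finset.card_union_of_disjoint hdis] at this
    omega
  obtain ⟨x, hx1, hx2⟩ := out hv hx Finset.subset_union_left hO
  obtain ⟨y, hy1, hy2⟩ := out hw hy Finset.subset_union_right hO'
  have hxO' : x ∈ O' := (Finset.mem_union.1 hx1).resolve_left fun h => hx2 (hx x h)
  have hyO : y ∈ O := (Finset.mem_union.1 hy1).resolve_right fun h => hy2 (hy y h)
  obtain ⟨i, hi, hiy⟩ := ex y hI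
  obtain ⟨i', hi', hix⟩ := ex x hI'
  have := hN y hyO i hi x hxO' i' hi' hiy.symm hix.symm
  tauto

end ColorSets

/-! ### Gaining at both arcs of an edge -/

section Gain

variable {ι α : Type*} {K : SimpleGraph ι} [DecidableEq ι]

/-- Here the middle edge is colored before the edge of `o'`, `i'`. Both `r` and `p` miss the list of
`o'` and `p` misses that of `i'`, whence the gains 2 and 1 there. -/
theorem ListColorable.of_rigid {U : Finset ι} {o i o' i' v w : ι} {A : ι → Finset α} {r p s q : α}
    (hU : v ∈ U ∧ w ∈ U ∧ i ∈ U ∧ o ∈ U)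
    (hne : v ≠ w ∧ v ≠ i ∧ v ≠ o ∧ w ≠ i ∧ w ≠ o ∧ i ≠ o)
    (vo' : K.Adj v o') (wo' : K.Adj w o') (wi' : K.Adj w i')
    (hA : ∀ b ∈ U, degIn K U b ≤ (A b).card + 1)
    (hr : r ∈ A v) (hp : p ∈ A w) (hs : s ∈ A i) (hq : q ∈ A o)
    (hcol : r ≠ p ∧ r ≠ s ∧ r ≠ q ∧ p ≠ q ∧ s ≠ q ∧ p ≠ s)
    (hro' : r ∉ A o') (hpo' : p ∉ A o') (hpi' : p ∉ A i')
    (h : SlackColorable α K (fun b => if b = o' then 2 else if b = i' then 1 else 0)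
      ((((U.erase v).erase w).erase i).erase o)) : ListColorable K U A := by
  classical
  obtain ⟨hv, hw, hi, ho⟩ := hU
  obtain ⟨n1, n2, n3, n4, n5, n6⟩ := hne
  obtain ⟨c1, c2, c3, c4, c5, c6⟩ := hcol
  have mem : ∀ {B : ι → Finset α} {a b : ι} {c d : α}, c ≠ d → d ∈ B b →
      d ∈ reduceLists K B a c b := by
    intro B a b c d hcd hd
    unfold reduceLists
    split_ifs
    · exact Finset.mem_erase.2 ⟨hcd.symm, hd⟩
    · exact hd
  have nmem : ∀ {B : ι → Finset α} {a b : ι} {c d : α}, d ∉ B b →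
      d ∉ reduceLists K B a c b := by
    intro B a b c d hd
    unfold reduceLists
    split_ifs
    · exact fun h => hd (Finset.mem_of_mem_erase h)
    · exact hd
  have hw' : w ∈ U.erase v := by simp [*, n1.symm]
  have hi' : i ∈ (U.erase v).erase w := by simp [*, n2.symm, n4.symm]
  have ho' : o ∈ ((U.erase v).erase w).erase i := by simp [*, n3.symm, n5.symm, n6.symm]
  refine .of_erase hr (.of_erase (a := w) (c := p) (mem c1 hp)
    (.of_erase (a := i) (c := s) (mem c6 (mem c2 hs))
    (.of_erase (a := o) (c := q) (mem c5 (mem c4 (mem c3 hq))) (h _ ?_))))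
  intro b hb
  have hbU : b ∈ U := by
      simp only [Finset.mem_erase] at hb
      exact hb.2.2.2.2
  have hb0 : degIn K U b + 0 ≤ (A b).card + 1 := hA b hbU
  apply slack_reduceLists ho'
  apply slack_reduceLists hi'
  dsimp only
  split_ifs with h1 h2
  · subst h1
    exact slack_reduceLists_of_notMem hw' wo' (nmem hpo')
      (slack_reduceLists_of_notMem hv vo' hro' hb0)
  · subst h2
    exact slack_reduceLists_of_notMem hw' wi' (nmem hpi') (slack_reduceLists hv hb0)
  · exact slack_reduceLists hw' (slack_reduceLists hv hb0)

/-- The adjacencies among the incidences on three edges of a path with middle edge `{v, w}`: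
`o, i` are on the third edge at the tail of `v`, and `o', i'` at the tail of `w`. -/
structure GainConfiguration (K : SimpleGraph ι) (U : Finset ι) (v w o i o' i' : ι) : Prop where
  mem : v ∈ U ∧ w ∈ U ∧ o ∈ U ∧ i ∈ U ∧ o' ∈ U ∧ i' ∈ U
  v_adj : K.Adj v w ∧ K.Adj v o ∧ K.Adj v i ∧ K.Adj v o'
  w_adj : K.Adj w o' ∧ K.Adj w i' ∧ K.Adj w o
  o_adj : K.Adj o i ∧ K.Adj o' i'
  v_not_adj : v ≠ i' ∧ ¬ K.Adj v i'
  w_not_adj : w ≠ i ∧ ¬ K.Adj w i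
  o_not_adj : o ≠ o' ∧ ¬ K.Adj o o' ∧ o ≠ i' ∧ ¬ K.Adj o i'
  i_not_adj : i ≠ o' ∧ ¬ K.Adj i o' ∧ i ≠ i' ∧ ¬ K.Adj i i'

/-- The premises `h1`, `h2`, `h3` are what remains after each of the three outcomes of
`exists_gain_or_rigid`: gains at both `v` and `w`, or rigidity from one side or the other. -/
theorem SlackColorable.of_gainConfiguration {g : ι → ℕ} {U : Finset ι} {v w o i o' i' : ι}
    (hc : GainConfiguration K U v w o i o' i')
    (dv : degIn K U v + g v = 7) (dw : degIn K U w + g w = 7) (dₒ : 5 ≤ degIn K U o + g o)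
    (di : 3 ≤ degIn K U i + g i) (do' : 5 ≤ degIn K U o' + g o') (di' : 3 ≤ degIn K U i' + g i')
    (h1 : SlackColorable α K (fun b => g b + if b = v ∨ b = w then 1 else 0)
      ((((U.erase o).erase i).erase o').erase i'))
    (h2 : SlackColorable α K (fun b => if b = o' then 2 else if b = i' then 1 else 0)
      ((((U.erase v).erase w).erase i).erase o))
    (h3 : SlackColorable α K (fun b => if b = o then 2 else if b = i then 1 else 0)
      ((((U.erase w).erase v).erase i').erase o')) : SlackColorable α K g U := by
  classical
  obtain ⟨⟨hv, hw, ho, hi, ho', hi'⟩, ⟨vw, vo, vi, vo'⟩, ⟨wo', wi', wo⟩, ⟨oi, oi'⟩, ⟨nvi', vi'⟩,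
    ⟨nwi, wi⟩, ⟨noo', oo', noi', oi''⟩, ⟨nio', io', nii', ii'⟩⟩ := hc
  -- Degree plus gain is 7 at `v` and `w`, so their lists can be trimmed to exactly six colors, as
  -- the counting requires.
  suffices H : ∀ A : ι → Finset α, (∀ b ∈ U, degIn K U b + g b ≤ (A b).card + 1) →
      (A v).card = 6 → (A w).card = 6 → ListColorable K U A by
    intro A hA
    have hAv := hA v hv
    have hAw := hA w hw
    obtain ⟨S, hS, hS6⟩ := Finset.exists_subset_card_eq (by omega : 6 ≤ (A v).card)
    obtain ⟨T, hT, hT6⟩ := Finset.exists_subset_card_eq (by omega : 6 ≤ (A w).card)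
    refine ListColorable.mono (A := Function.update (Function.update A v S) w T) ?_ (H _ ?_ ?_ ?_)
    · intro a _
      by_cases haw : a = w
      · subst haw; simpa using hT
      · by_cases hav : a = v
        · subst hav; simpa [haw] using hS
        · simp [haw, hav]
    · intro a ha
      by_cases haw : a = w
      · subst haw; simp; omega
      · by_cases hav : a = v
        · subst hav; simp [haw]; omega
        · simpa [haw, hav] using hA a ha
    · simp [vw.ne, hS6]
    · simp [hT6]
  intro A hA hv6 hw6
  have hAo := hA o ho
  have hAi := hA i hi
  have hAo' := hA o' ho'
  have hAi' := hA i' hi'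
  have hA0 : ∀ b ∈ U, degIn K U b ≤ (A b).card + 1 := fun b hb => by have := hA b hb; omega
  rcases exists_gain_or_rigid (by omega : 4 ≤ (A o).card) (by omega : 2 ≤ (A i).card)
    (by omega : 4 ≤ (A o').card) (by omega : 2 ≤ (A i').card) hv6 hw6 with h | h | h
  · obtain ⟨c, hc, d, hd, c', hc', d', hd', hcd, hcd', hgv, hgw⟩ := h
    have mi : i ∈ U.erase o := by simp [*, oi.ne']
    have mo' : o' ∈ (U.erase o).erase i := by simp [*, noo'.symm, nio'.symm]
    have mi' : i' ∈ ((U.erase o).erase i).erase o' := by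
      simp [*, oi'.ne', nii'.symm, noi'.symm]
    have ri : reduceLists K A o c i = (A i).erase c := reduceLists_of_adj oi
    have ro' : reduceLists K (reduceLists K A o c) i d o' = A o' := by
      rw [reduceLists_of_not_adj io', reduceLists_of_not_adj oo']
    have ri' : reduceLists K (reduceLists K (reduceLists K A o c) i d) o' c' i'
        = (A i').erase c' := by
      rw [reduceLists_of_adj oi', reduceLists_of_not_adj ii', reduceLists_of_not_adj oi'']
    refine .of_erase hc (.of_erase (a := i) (c := d) (by rw [ri]; simp [hd, hcd.symm])
      (.of_erase (a := o') (c := c') (by rwa [ro'])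
      (.of_erase (a := i') (c := d') (by rw [ri']; simp [hd', hcd'.symm]) (h1 _ ?_))))
    intro b hb
    have hbU : b ∈ U := by
      simp only [Finset.mem_erase] at hb
      exact hb.2.2.2.2
    have hb0 := hA b hbU
    dsimp only
    split_ifs with hbvw
    · rcases hbvw with rfl | rfl
      · have e1 : reduceLists K A o c b = (A b).erase c := reduceLists_of_adj vo.symm
        have e2 : reduceLists K (reduceLists K A o c) i d b = ((A b).erase c).erase d := by
          rw [reduceLists_of_adj vi.symm, e1]
        apply slack_reduceLists mi'
        by_cases g1 : c ∉ A b
        · exact slack_reduceLists mo' (slack_reduceLists mi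
            (slack_reduceLists_of_notMem ho vo.symm g1 hb0))
        by_cases g2 : d ∉ A b
        · exact slack_reduceLists mo' (slack_reduceLists_of_notMem mi vi.symm
            (by rw [e1]; exact fun h => g2 (Finset.mem_of_mem_erase h)) (slack_reduceLists ho hb0))
        · have g3 : c' ∉ ((A b).erase c).erase d := by
            rcases hgv with h | h | h | h | h
            · exact absurd h g1
            · exact absurd h g2
            · simp [h]
            · simp [h]
            · simp [h]
          exact slack_reduceLists_of_notMem mo' vo'.symm (by rwa [e2])
            (slack_reduceLists mi (slack_reduceLists ho hb0))
      · have e1 : reduceLists K A o c b = (A b).erase c := reduceLists_of_adj wo.symm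
        have e2 : reduceLists K (reduceLists K A o c) i d b = (A b).erase c := by
          rw [reduceLists_of_not_adj (fun h => wi h.symm), e1]
        have e3 : reduceLists K (reduceLists K (reduceLists K A o c) i d) o' c' b
            = ((A b).erase c).erase c' := by
          rw [reduceLists_of_adj wo'.symm, e2]
        by_cases g1 : c ∉ A b
        · exact slack_reduceLists mi' (slack_reduceLists mo' (slack_reduceLists mi
            (slack_reduceLists_of_notMem ho wo.symm g1 hb0)))
        by_cases g2 : c' ∉ A b ∨ c = c'
        · exact slack_reduceLists mi' (slack_reduceLists_of_notMem mo' wo'.symm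
            (by rw [e2]; rcases g2 with h | h <;> simp [h])
            (slack_reduceLists mi (slack_reduceLists ho hb0)))
        · rw [not_or] at g2
          have g3 : d' ∉ ((A b).erase c).erase c' := by
            rcases hgw with h | h | h | h | h
            · exact absurd h g1
            · exact absurd h g2.1
            · simp [h]
            · simp [h]
            · exact absurd h g2.2
          exact slack_reduceLists_of_notMem mi' wi'.symm (by rwa [e3])
            (slack_reduceLists mo' (slack_reduceLists mi (slack_reduceLists ho hb0)))
    · exact slack_reduceLists mi' (slack_reduceLists mo' (slack_reduceLists mi
        (slack_reduceLists ho hb0)))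
  · obtain ⟨r, hr, p, hp, s, hs, q, hq, n1, n2, n3, n4, n5, n6, n7, n8, n9⟩ := h
    exact .of_rigid ⟨hv, hw, hi, ho⟩ ⟨vw.ne, vi.ne, vo.ne, nwi, wo.ne, oi.ne'⟩
      vo' wo' wi' hA0 hr hp hs hq ⟨n1, n2, n3, n4, n5, n6⟩ n7 n8 n9 h2
  · obtain ⟨r, hr, p, hp, s, hs, q, hq, n1, n2, n3, n4, n5, n6, n7, n8, n9⟩ := h
    exact .of_rigid ⟨hw, hv, hi', ho'⟩ ⟨vw.ne', wi'.ne, wo'.ne, nvi', vo'.ne, oi'.ne'⟩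
      wo vo vi hA0 hr hp hs hq ⟨n1, n2, n3, n4, n5, n6⟩ n7 n8 n9 h3

end Gain

/-! ### Choosability of `K_{2,…,2}` -/

section Multipartite

/-- A complete multipartite graph with parts of size two is colorable from lists whose size is the
number of parts. -/
theorem exists_coloring_of_card_le {ι α : Type*} [DecidableEq ι] [DecidableEq α] (s : Finset ι)
    [Nonempty α] (A : ι → Bool → Finset α) (hA : ∀ i ∈ s, ∀ b, s.card ≤ (A i b).card) :
    ∃ φ : ι → Bool → α, (∀ i ∈ s, ∀ b, φ i b ∈ A i b) ∧
      ∀ i ∈ s, ∀ j ∈ s, i ≠ j → ∀ b b', φ i b ≠ φ j b' := by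
  induction hn : s.card generalizing s A with
  | zero =>
    rw [Finset.card_eq_zero] at hn
    subst hn
    exact ⟨fun _ _ => Classical.arbitrary α, by simp, by simp⟩
  | succ n ih =>
    -- A color common to both lists of a part is used twice there and deleted elsewhere. If no part
    -- has one, Hall's theorem gives distinct colors: a family containing both members of a part
    -- sees at least `2 * s.card` colors, and any other has at most `s.card` members.
    by_cases hshare : ∃ i ∈ s, ∃ c, c ∈ A i false ∧ c ∈ A i true
    · obtain ⟨i, hi, c, hc, hc'⟩ := hshare
      obtain ⟨φ, h1, h2⟩ := ih (s.erase i) (fun j b => (A j b).erase c) (by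
        intro j hj b
        have e1 := hA j (Finset.mem_of_mem_erase hj) b
        have e2 := Finset.pred_card_le_card_erase (s := A j b) (a := c)
        have e3 := Finset.card_erase_of_mem hi
        omega) (by rw [Finset.card_erase_of_mem hi, hn]; rfl)
      refine ⟨Function.update φ i fun _ => c, ?_, ?_⟩
      · intro j hj b
        by_cases hji : j = i
        · subst hji; cases b <;> simpa
        · rw [Function.update_of_ne hji]
          exact Finset.mem_of_mem_erase (h1 j (Finset.mem_erase.2 ⟨hji, hj⟩) b)
      · intro j hj k hk hjk b b'
        by_cases hji : j = i
        · subst hji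
          rw [Function.update_self, Function.update_of_ne hjk.symm]
          exact (Finset.ne_of_mem_erase (h1 k (Finset.mem_erase.2 ⟨hjk.symm, hk⟩) b')).symm
        · by_cases hki : k = i
          · subst hki
            rw [Function.update_self, Function.update_of_ne hji]
            exact Finset.ne_of_mem_erase (h1 j (Finset.mem_erase.2 ⟨hji, hj⟩) b)
          · rw [Function.update_of_ne hji, Function.update_of_ne hki]
            exact h2 j (Finset.mem_erase.2 ⟨hji, hj⟩) k (Finset.mem_erase.2 ⟨hki, hk⟩) hjk b b'
    · push Not at hshare
      obtain ⟨f, hf, hfA⟩ := (Finset.all_card_le_biUnion_card_iff_exists_injective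
        (fun p : s × Bool => A p.1 p.2)).1 (by
          intro T
          by_cases hT : Set.InjOn Prod.fst (T : Set (s × Bool))
          · rcases T.eq_empty_or_nonempty with rfl | ⟨p, hp⟩
            · simp
            · calc T.card = (T.image Prod.fst).card := (Finset.card_image_of_injOn hT).symm
                _ ≤ Fintype.card s := Finset.card_le_univ _
                _ = s.card := Fintype.card_coe s
                _ ≤ (A p.1 p.2).card := hA _ p.1.2 _
                _ ≤ _ := Finset.card_le_card
                  (Finset.subset_biUnion_of_mem (fun p : s × Bool => A p.1 p.2) hp)
          · simp only [Set.InjOn, not_forall] at hT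
            obtain ⟨⟨i, b⟩, hp, ⟨j, b'⟩, hp', hij, hne⟩ := hT
            dsimp only at hij
            subst hij
            have hsub : A i false ∪ A i true ⊆ T.biUnion fun p : s × Bool => A p.1 p.2 := by
              have e1 := Finset.subset_biUnion_of_mem (fun p : s × Bool => A p.1 p.2) hp
              have e2 := Finset.subset_biUnion_of_mem (fun p : s × Bool => A p.1 p.2) hp'
              cases b <;> cases b' <;> simp at hne e1 e2 ⊢
              · exact Finset.union_subset e1 e2
              · exact Finset.union_subset e2 e1
            calc T.card ≤ Fintype.card (s × Bool) := Finset.card_le_univ _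
              _ = s.card + s.card := by simp [mul_two]
              _ ≤ (A i false).card + (A i true).card := add_le_add (hA _ i.2 _) (hA _ i.2 _)
              _ = (A i false ∪ A i true).card :=
                (Finset.card_union_of_disjoint (Finset.disjoint_left.2 (hshare i i.2))).symm
              _ ≤ _ := Finset.card_le_card hsub)
      obtain ⟨i0, hi0⟩ : s.Nonempty := by rw [← Finset.card_pos]; omega
      refine ⟨fun i b => if h : i ∈ s then f (⟨i, h⟩, b) else f (⟨i0, hi0⟩, true), ?_, ?_⟩
      · intro i hi b
        simpa [hi] using hfA (⟨i, hi⟩, b)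
      · intro i hi j hj hij b b'
        simp only [hi, hj, dif_pos]
        intro h
        have := hf h
        simp at this
        exact hij this.1

end Multipartite

end IncidenceChoosability

namespace IncidenceChoosability

/-! ### The conflict graph of arcs -/

section Arcs

variable {V : Type*}

/-- The conflict graph of arcs: the arc `(u, v)` stands for the incidence of `u` with `uv`. -/
def arcGraph (V : Type*) : SimpleGraph (V × V) where
  Adj p q := p ≠ q ∧ (p.1 = q.1 ∨ p.2 = q.1 ∨ q.2 = p.1)
  symm := ⟨fun _ _ h => ⟨h.1.symm, by tauto⟩⟩
  loopless := ⟨fun _ h => h.1 rfl⟩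

theorem arcGraph_adj {p q : V × V} :
    (arcGraph V).Adj p q ↔ p ≠ q ∧ (p.1 = q.1 ∨ p.2 = q.1 ∨ q.2 = p.1) := Iff.rfl

/-- Two arcs of a triangle conflict exactly when their heads differ, so the conflict graph is
`K_{2,2,2}`; every degree is 4 and every list has at least three colors. -/
theorem slackColorable_triangle {α : Type*} [Nonempty α] [DecidableEq V] {g : V × V → ℕ} {a b c : V}
    (hab : a ≠ b) (hbc : b ≠ c) (hac : a ≠ c) :
    SlackColorable α (arcGraph V) g {(a, b), (b, a), (a, c), (c, a), (b, c), (c, b)} := by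
  classical
  intro A hA
  -- The part of head `t` consists of the arcs with tails `nxt t` and `prv t`, told apart by the
  -- Boolean.
  let nxt : V → V := fun t => if t = a then b else if t = b then c else a
  let prv : V → V := fun t => if t = a then c else if t = b then a else b
  have key : ∀ p ∈ ({(a, b), (b, a), (a, c), (c, a), (b, c), (c, b)} : Finset (V × V)),
      3 ≤ (A p).card := by
    intro p hp
    have h1 := hA p hp
    have h2 : 4 ≤ degIn (arcGraph V) {(a, b), (b, a), (a, c), (c, a), (b, c), (c, b)} p := by
      have card4 : (({(a, b), (b, a), (a, c), (c, a), (b, c), (c, b)} : Finset (V × V)).filter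
          fun q => q.2 ≠ p.2).card = 4 := by
        simp only [Finset.mem_insert, Finset.mem_singleton] at hp
        rcases hp with rfl | rfl | rfl | rfl | rfl | rfl <;>
        simp [Finset.filter_insert, Finset.filter_singleton, hab, hbc, hac, hab.symm, hbc.symm,
          hac.symm]
      rw [← card4]
      apply card_le_degIn
      rintro q hq
      rw [Finset.mem_filter] at hq
      refine ⟨hq.1, fun h => hq.2 (h ▸ rfl), ?_⟩
      have hq1 := hq.1
      have hq2 := hq.2
      simp only [Finset.mem_insert, Finset.mem_singleton] at hp hq1
      rcases hp with rfl | rfl | rfl | rfl | rfl | rfl <;>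
      rcases hq1 with rfl | rfl | rfl | rfl | rfl | rfl <;>
      first
        | exact absurd rfl hq2
        | exact Or.inl rfl
        | exact Or.inr (Or.inl rfl)
        | exact Or.inr (Or.inr rfl)
    omega
  obtain ⟨φ, h1, h2⟩ := exists_coloring_of_card_le ({a, b, c} : Finset V)
    (fun t i => A (if i then nxt t else prv t, t)) (by
      intro t ht i
      rw [show ({a, b, c} : Finset V).card = 3 by simp [hab, hbc, hac]]
      apply key
      simp only [Finset.mem_insert, Finset.mem_singleton] at ht
      rcases ht with rfl | rfl | rfl <;> cases i <;>
        simp [nxt, prv, hab, hbc, hac, hab.symm, hbc.symm, hac.symm])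
  refine ⟨fun p => φ p.2 (decide (p.1 = nxt p.2)), ?_, ?_⟩
  · intro p hp
    have := h1 p.2 (by simp at hp ⊢; rcases hp with rfl | rfl | rfl | rfl | rfl | rfl <;> simp)
      (decide (p.1 = nxt p.2))
    suffices hpe : p = (if decide (p.1 = nxt p.2) = true then nxt p.2 else prv p.2, p.2) by
      rw [← hpe] at this
      exact this
    clear this h1 h2 key hA
    simp only [Finset.mem_insert, Finset.mem_singleton] at hp
    rcases hp with rfl | rfl | rfl | rfl | rfl | rfl <;>
      simp [nxt, prv, hac, hab.symm, hbc.symm, hac.symm]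
  · intro p hp q hq hpq
    have e : ∀ r ∈ ({(a, b), (b, a), (a, c), (c, a), (b, c), (c, b)} : Finset (V × V)),
        r.2 ∈ ({a, b, c} : Finset V) ∧ r.1 ≠ r.2 := by
      intro r hr
      simp only [Finset.mem_insert, Finset.mem_singleton] at hr
      rcases hr with rfl | rfl | rfl | rfl | rfl | rfl <;> simp [*, hab.symm, hbc.symm, hac.symm]
    refine h2 p.2 (e p hp).1 q.2 (e q hq).1 ?_ _ _
    intro h
    rcases hpq.2 with h' | h' | h'
    · exact hpq.1 (Prod.ext h' h)
    · exact (e q hq).2 (h'.symm.trans h)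
    · exact (e p hp).2 (h'.symm.trans h.symm)

open scoped Classical in
/-- The arcs of a graph. -/
noncomputable def arcs [Fintype V] (H : SimpleGraph V) : Finset (V × V) :=
  Finset.univ.filter fun p => H.Adj p.1 p.2


variable [Fintype V] {α : Type*}

@[simp]
theorem mem_arcs {H : SimpleGraph V} {p : V × V} : p ∈ arcs H ↔ H.Adj p.1 p.2 := by
  simp [arcs]

/-- The three summands count the other arcs out of `u`, all arcs out of `v` (among them `(v, u)`),
and the other arcs into `u`. -/
theorem degIn_arcs_le {H : SimpleGraph V} {u v : V} (huv : H.Adj u v) {k l : ℕ}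
    (hu : (H.neighborSet u).ncard ≤ k + 1) (hv : (H.neighborSet v).ncard ≤ l) :
    degIn (arcGraph V) (arcs H) (u, v) ≤ k + l + k := by
  classical
  have card_eq : ∀ x, (H.neighborFinset x).card = (H.neighborSet x).ncard := fun x => by
    rw [Set.ncard_eq_toFinset_card', SimpleGraph.neighborFinset]
  rw [← card_eq] at hu hv
  have hu' : ((H.neighborFinset u).erase v).card ≤ k := by
    rw [Finset.card_erase_of_mem (by simpa using huv)]; omega
  have hsub : (arcs H).filter ((arcGraph V).Adj (u, v)) ⊆
      ((H.neighborFinset u).erase v).image (fun x => (u, x)) ∪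
      (H.neighborFinset v).image (fun x => (v, x)) ∪
      ((H.neighborFinset u).erase v).image (fun x => (x, u)) := by
    rintro ⟨x, y⟩ h
    simp only [Finset.mem_filter, mem_arcs, arcGraph_adj, ne_eq, Prod.mk.injEq] at h
    simp only [Finset.mem_union, Finset.mem_image, Finset.mem_erase,
      SimpleGraph.mem_neighborFinset, Prod.mk.injEq]
    obtain ⟨hxy, hne, h | h | h⟩ := h
    · subst h; left; left; exact ⟨y, ⟨fun h => hne ⟨rfl, h.symm⟩, hxy⟩, rfl, rfl⟩
    · subst h; left; right; exact ⟨y, hxy, rfl, rfl⟩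
    · subst h
      by_cases hx : x = v
      · subst hx; left; right; exact ⟨y, hxy, rfl, rfl⟩
      · right; exact ⟨x, ⟨hx, hxy.symm⟩, rfl, rfl⟩
  refine (Finset.card_le_card hsub).trans ((Finset.card_union_le _ _).trans
    (add_le_add ((Finset.card_union_le _ _).trans (add_le_add ?_ ?_)) ?_))
  · exact Finset.card_image_le.trans hu'
  · exact Finset.card_image_le.trans hv
  · exact Finset.card_image_le.trans hu'

/-- Slack colorability spreads from an edge along a connected graph. -/
theorem SlackColorable.union_arcs [DecidableEq V] {g : V × V → ℕ} {Z : Finset (V × V)}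
    {H : SimpleGraph V} {z z' : V} (hz : (z, z') ∈ Z) (hz' : (z', z) ∈ Z) (hne : z ≠ z')
    (hreach : ∀ x y, H.Adj x y → H.Reachable z x)
    (h : SlackColorable α (arcGraph V) g Z) :
    SlackColorable α (arcGraph V) g (Z ∪ arcs H) := by
  classical
  -- A maximal slack-colorable set above `Z` is closed under adding arcs of `H` with two neighbors
  -- in it.
  obtain ⟨U, hU, hmax⟩ := Finset.exists_max_image
    ((Z ∪ arcs H).powerset.filter fun U => Z ⊆ U ∧ SlackColorable α (arcGraph V) g U) Finset.card
    ⟨Z, Finset.mem_filter.2 ⟨Finset.mem_powerset.2 Finset.subset_union_left, subset_rfl, h⟩⟩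
  simp only [Finset.mem_filter, Finset.mem_powerset] at hU hmax
  obtain ⟨hUs, hZU, hUg⟩ := hU
  have closed : ∀ p ∈ arcs H, 2 ≤ degIn (arcGraph V) U p → p ∈ U := by
    intro p hp hd
    by_contra hpU
    have := hmax (insert p U) ⟨Finset.insert_subset (Finset.mem_union_right _ hp) hUs,
      hZU.trans (Finset.subset_insert _ _), hUg.insert_of_two_le hpU (by omega)⟩
    rw [Finset.card_insert_of_notMem hpU] at this
    omega
  -- Both arcs of `xt` are neighbors of `(x, y)`; then `(x, t)` and `(x, y)` are two neighbors of
  -- `(y, x)`.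
  have step : ∀ x y t, x ≠ t → (x, t) ∈ U → (t, x) ∈ U → H.Adj x y →
      (x, y) ∈ U ∧ (y, x) ∈ U := by
    intro x y t hxt h1 h2 hxy
    by_cases hyt : y = t
    · subst hyt; exact ⟨h1, h2⟩
    have h3 : (x, y) ∈ U := by
      refine closed _ (by simpa using hxy) (two_le_degIn h1 h2 ?_ ?_ ?_)
      · simp [hxt]
      · simp [arcGraph_adj, hyt]
      · simp [arcGraph_adj, hxt]
    refine ⟨h3, closed _ (by simpa using hxy.symm) (two_le_degIn h1 h3 ?_ ?_ ?_)⟩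
    · simp [Ne.symm hyt]
    · simp [arcGraph_adj, hxy.ne']
    · simp [arcGraph_adj, hxy.ne']
  have active : ∀ x, H.Reachable z x → ∃ t, x ≠ t ∧ (x, t) ∈ U ∧ (t, x) ∈ U := by
    rintro x ⟨w⟩
    suffices ∀ {y x} (w : H.Walk y x), (∃ t, y ≠ t ∧ (y, t) ∈ U ∧ (t, y) ∈ U) →
        ∃ t, x ≠ t ∧ (x, t) ∈ U ∧ (t, x) ∈ U from this w ⟨z', hne, hZU hz, hZU hz'⟩
    intro y x w
    induction w with
    | nil => exact id
    | cons hadj _ ih =>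
      rintro ⟨t, h1, h2, h3⟩
      have := step _ _ t h1 h2 h3 hadj
      exact ih ⟨_, hadj.ne', this.2, this.1⟩
  have : Z ∪ arcs H = U := by
    refine Finset.Subset.antisymm (Finset.union_subset hZU ?_) hUs
    rintro ⟨x, y⟩ hxy
    have hxy' : H.Adj x y := by simpa using hxy
    obtain ⟨t, h1, h2, h3⟩ := active x (hreach x y hxy')
    exact (step x y t h1 h2 h3 hxy').1
  rwa [this]

set_option linter.unusedSimpArgs false in
open SimpleGraph in
/-- If everything is connected to `a` by the graph `H`, then the arcs on the edges `am`, `bm'` can be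
colored with a gain at both arcs on the edge `ab`. -/
theorem SlackColorable.of_sup_edges [Nonempty α] [DecidableEq V] {g : V × V → ℕ} {H : SimpleGraph V}
    {a b m m' e c : V} (hab : a ≠ b) (hma : m ≠ a) (hmb : m ≠ b) (hma' : m' ≠ a) (hmb' : m' ≠ b)
    (hmm : m ≠ m') (nab : ¬ H.Adj a b) (nam : ¬ H.Adj a m) (nbm : ¬ H.Adj b m')
    (hae : H.Adj a e) (hbc : H.Adj b c) (hr : ∀ x y, H.Adj x y → H.Reachable a x)
    (hdeg : ∀ x, ((H ⊔ edge a b ⊔ edge a m ⊔ edge b m').neighborSet x).ncard ≤ 3)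
    (hga : g (a, b) = 0) (hgb : g (b, a) = 0)
    (h : SlackColorable α (arcGraph V) (fun p => g p + if p = (a, b) ∨ p = (b, a) then 1 else 0)
      (arcs (H ⊔ edge a b))) :
    SlackColorable α (arcGraph V) g (arcs (H ⊔ edge a b ⊔ edge a m ⊔ edge b m')) := by
  classical
  have hrb : ∀ x y, H.Adj x y → H.Reachable b x := fun x y hxy =>
    (hr b c hbc).symm.trans (hr x y hxy)
  have hem : e ≠ m := by rintro rfl; exact nam hae
  have hcm : c ≠ m' := by rintro rfl; exact nbm hbc
  have hea : e ≠ a := hae.ne'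
  have hcb : c ≠ b := hbc.ne'
  have heb : e ≠ b := by rintro rfl; exact nab hae
  have hca : c ≠ a := by rintro rfl; exact nab hbc.symm
  -- A single edge with gains 2 and 1 is itself a core: the arc with gain 2 can be colored last of
  -- all.
  have seed : ∀ {p q : V}, p ≠ q → SlackColorable α (arcGraph V)
      (fun x => if x = (p, q) then 2 else if x = (q, p) then 1 else 0) {(p, q), (q, p)} := by
    intro p q hpq
    have h0 := (SlackColorable.empty (α := α) (K := arcGraph V)
      (fun x => if x = (p, q) then 2 else if x = (q, p) then 1 else 0))
    have h1 := h0.insert_of_two_le (a := (p, q)) (by simp) (by simp)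
    have h2 := h1.insert_of_two_le (a := (q, p)) (by simp [hpq.symm]) (by
      have := one_le_degIn (K := arcGraph V) (U := insert (p, q) ∅) (a := (q, p)) (b := (p, q))
        (by simp) (by simp [arcGraph_adj, hpq.symm])
      simp only [Prod.mk.injEq, hpq, hpq.symm, and_self, if_true, if_false]
      omega)
    convert h2 using 1
    ext x
    simp only [Finset.mem_insert, Finset.mem_singleton, Finset.notMem_empty]
    tauto
  apply SlackColorable.of_gainConfiguration (v := (a, b)) (w := (b, a)) (o := (a, m)) (i := (m, a))
    (o' := (b, m')) (i' := (m', b))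
  · constructor <;>
    simp [arcGraph_adj, edge_adj, hab, hab.symm, hma, hma.symm, hmb, hmb.symm, hma', hma'.symm,
      hmb', hmb'.symm, hmm, hmm.symm]
  · have h1 := degIn_arcs_le (k := 2) (l := 3) (u := a) (v := b)
      (H := H ⊔ edge a b ⊔ edge a m ⊔ edge b m') (by simp [edge_adj, hab]) (hdeg a) (hdeg b)
    have h2 := card_le_degIn (K := arcGraph V) (U := arcs (H ⊔ edge a b ⊔ edge a m ⊔ edge b m'))
      (a := (a, b)) {(a, m), (m, a), (a, e), (e, a), (b, a), (b, m'), (b, c)} (by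
        simp [arcGraph_adj, edge_adj, *, hab.symm, hma.symm, hmb.symm, hma'.symm, hmb'.symm,
          hmm.symm, hae.symm, heb.symm])
    have h3 : ({(a, m), (m, a), (a, e), (e, a), (b, a), (b, m'), (b, c)} : Finset (V × V)).card
        = 7 := by
      simp [*, hab.symm, hma.symm, hmb.symm, hma'.symm, hmb'.symm,
          hmm.symm, heb.symm, hem.symm, hea.symm, hcm.symm, hcb.symm, hca.symm]
    omega
  · have h1 := degIn_arcs_le (k := 2) (l := 3) (u := b) (v := a)
      (H := H ⊔ edge a b ⊔ edge a m ⊔ edge b m') (by simp [edge_adj, hab.symm]) (hdeg b) (hdeg a)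
    have h2 := card_le_degIn (K := arcGraph V) (U := arcs (H ⊔ edge a b ⊔ edge a m ⊔ edge b m'))
      (a := (b, a)) {(b, m'), (m', b), (b, c), (c, b), (a, b), (a, m), (a, e)} (by
        simp [arcGraph_adj, edge_adj, *, hab, hab.symm, hma.symm, hmb.symm, hma'.symm, hmb'.symm,
          hmm.symm, hbc.symm, hca.symm])
    have h3 : ({(b, m'), (m', b), (b, c), (c, b), (a, b), (a, m), (a, e)} : Finset (V × V)).card
        = 7 := by
      simp [*, hab.symm, hma.symm, hmb.symm, hma'.symm, hmb'.symm,
          hmm.symm, heb.symm, hem.symm, hea.symm, hcm.symm, hcb.symm, hca.symm]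
    omega
  · have h2 := card_le_degIn (K := arcGraph V) (U := arcs (H ⊔ edge a b ⊔ edge a m ⊔ edge b m'))
      (a := (a, m)) {(m, a), (a, b), (b, a), (a, e), (e, a)} (by
        simp [arcGraph_adj, edge_adj, *, hab.symm, hma.symm, hmb.symm, hae.symm, hem.symm])
    have h3 : ({(m, a), (a, b), (b, a), (a, e), (e, a)} : Finset (V × V)).card = 5 := by
      simp [*, hab.symm, hma.symm, hmb.symm, heb.symm, hem.symm, hea.symm]
    omega
  · have h2 := card_le_degIn (K := arcGraph V) (U := arcs (H ⊔ edge a b ⊔ edge a m ⊔ edge b m'))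
      (a := (m, a)) {(a, m), (a, b), (a, e)} (by
        simp [arcGraph_adj, edge_adj, *, hab.symm, hma.symm, hmb.symm, hae.symm, hem.symm])
    have h3 : ({(a, m), (a, b), (a, e)} : Finset (V × V)).card = 3 := by
      simp [*, hab.symm, hma.symm, hmb.symm, heb.symm, hem.symm, hea.symm]
    omega
  · have h2 := card_le_degIn (K := arcGraph V) (U := arcs (H ⊔ edge a b ⊔ edge a m ⊔ edge b m'))
      (a := (b, m')) {(m', b), (b, a), (a, b), (b, c), (c, b)} (by
        simp [arcGraph_adj, edge_adj, *, hab.symm, hma'.symm, hmb'.symm, hbc.symm, hcm.symm])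
    have h3 : ({(m', b), (b, a), (a, b), (b, c), (c, b)} : Finset (V × V)).card = 5 := by
      simp [*, hab.symm, hma'.symm, hmb'.symm, hca.symm, hcm.symm, hcb.symm]
    omega
  · have h2 := card_le_degIn (K := arcGraph V) (U := arcs (H ⊔ edge a b ⊔ edge a m ⊔ edge b m'))
      (a := (m', b)) {(b, m'), (b, a), (b, c)} (by
        simp [arcGraph_adj, edge_adj, *, hab.symm, hma'.symm, hmb'.symm, hbc.symm, hcm.symm])
    have h3 : ({(b, m'), (b, a), (b, c)} : Finset (V × V)).card = 3 := by
      simp [*, hab.symm, hma'.symm, hmb'.symm, hca.symm, hcm.symm, hcb.symm]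
    omega
  · convert h using 1
    ext ⟨x, y⟩
    have := H.symm
    simp only [Finset.mem_erase, mem_arcs, sup_adj, edge_adj, ne_eq, Prod.mk.injEq]
    have hs := fun x y => H.adj_comm x y
    grind
  -- In the rigid case exactly the edge `bm'` and `H` remain uncolored, and the seed `bm'` spreads
  -- through `H`; the other rigid case uses `am`.
  · convert (seed hmb'.symm).union_arcs (H := H) (z := b) (z' := m') (by simp) (by simp) hmb'.symm
      hrb using 1
    ext ⟨x, y⟩
    simp only [Finset.mem_erase, Finset.mem_union, Finset.mem_insert, Finset.mem_singleton,
      mem_arcs, sup_adj, edge_adj, ne_eq, Prod.mk.injEq]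
    have hs := fun x y => H.adj_comm x y
    grind
  · convert (seed hma.symm).union_arcs (H := H) (z := a) (z' := m) (by simp) (by simp) hma.symm
      hr using 1
    ext ⟨x, y⟩
    simp only [Finset.mem_erase, Finset.mem_union, Finset.mem_insert, Finset.mem_singleton,
      mem_arcs, sup_adj, edge_adj, ne_eq, Prod.mk.injEq]
    have hs := fun x y => H.adj_comm x y
    grind

end Arcs

end IncidenceChoosability

namespace IncidenceChoosability

/-! ### Cores in triangle-free graphs -/

section CycleBlock

open SimpleGraph

variable {V : Type*} {α : Type*}

/-- The path `x k, x (k + 1), …, x l` as a graph. -/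
def segment (x : ℕ → V) (k l : ℕ) : SimpleGraph V :=
  fromEdgeSet {e | ∃ t, k ≤ t ∧ t < l ∧ e = s(x t, x (t + 1))}

theorem segment_adj {x : ℕ → V} {k l : ℕ} {u v : V} :
    (segment x k l).Adj u v ↔ (∃ t, k ≤ t ∧ t < l ∧ s(u, v) = s(x t, x (t + 1))) ∧ u ≠ v := by
  simp [segment, fromEdgeSet_adj]

theorem exists_of_segment_adj {x : ℕ → V} {k l : ℕ} {u v : V} (h : (segment x k l).Adj u v) :
    (∃ t, k ≤ t ∧ t ≤ l ∧ u = x t) ∧ ∃ t, k ≤ t ∧ t ≤ l ∧ v = x t := by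
  obtain ⟨⟨t, h1, h2, h3⟩, -⟩ := segment_adj.1 h
  rw [Sym2.eq_iff] at h3
  rcases h3 with ⟨h, h'⟩ | ⟨h, h'⟩
  · exact ⟨⟨t, h1, h2.le, h⟩, ⟨t + 1, by omega, h2, h'⟩⟩
  · exact ⟨⟨t + 1, by omega, h2, h⟩, ⟨t, h1, h2.le, h'⟩⟩

theorem segment_reachable {x : ℕ → V} {k l t : ℕ} (hx : ∀ t, k ≤ t → t < l → x t ≠ x (t + 1))
    (hk : k ≤ t) (ht : t ≤ l) : (segment x k l).Reachable (x l) (x t) := by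
  induction ht using Nat.decreasingInduction with
  | self => rfl
  | of_succ j hj ih =>
    refine (ih (by omega)).trans (Adj.reachable ?_)
    exact segment_adj.2 ⟨⟨j, hk, hj, Sym2.eq_swap⟩, (hx j hk hj).symm⟩

variable [Fintype V]

theorem exists_adj_ne_ne {G : SimpleGraph V} {v : V} (h : 3 ≤ (G.neighborSet v).ncard) (p q : V) :
    ∃ m, G.Adj v m ∧ m ≠ p ∧ m ≠ q := by
  by_contra hcon
  push Not at hcon
  have hsub : G.neighborSet v ⊆ {p, q} := by
    intro m hm
    by_cases hp : m = p
    · exact Or.inl hp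
    · exact Or.inr (hcon m hm hp)
  have := (Set.ncard_le_ncard hsub (Set.toFinite _)).trans (Set.ncard_insert_le _ _)
  rw [Set.ncard_singleton] at this
  omega

/-- The arcs of the cycle `x 0, x 1, …, x (k + 3)` are slack colorable as soon as there is a gain at
the four arcs on the edges `x 0 x 1` and `x (k + 2) x (k + 3)`. -/
theorem slackColorable_cycle [Nonempty α] {x : ℕ → V} {k : ℕ}
    (hinj : ∀ s t, s < k + 4 → t < k + 4 → x s = x t → s = t) {g : V × V → ℕ}
    (hg1 : g (x 0, x 1) = 1) (hg2 : g (x 1, x 0) = 1)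
    (hg3 : g (x (k + 2), x (k + 3)) = 1) (hg4 : g (x (k + 3), x (k + 2)) = 1) :
    SlackColorable α (arcGraph V) g (arcs (segment x 2 (k + 2) ⊔ edge (x 1) (x 2) ⊔
      edge (x 0) (x (k + 3)) ⊔ edge (x 0) (x 1) ⊔ edge (x (k + 2)) (x (k + 3)))) := by
  classical
  have hne : ∀ s t, s < k + 4 → t < k + 4 → s ≠ t → x s ≠ x t :=
    fun s t hs ht h h' => h (hinj s t hs ht h')
  have hseg : ∀ {u v : V}, (segment x 2 (k + 2)).Adj u v → u ≠ x 0 ∧ u ≠ x 1 ∧ u ≠ x (k + 3) ∧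
      v ≠ x 0 ∧ v ≠ x 1 ∧ v ≠ x (k + 3) := by
    intro u v h
    obtain ⟨⟨s, h1, h2, rfl⟩, ⟨t, h3, h4, rfl⟩⟩ := exists_of_segment_adj h
    refine ⟨?_, ?_, ?_, ?_, ?_, ?_⟩ <;> apply hne <;> omega
  have hreach : ∀ u v, (segment x 2 (k + 2)).Adj u v →
      (segment x 2 (k + 2)).Reachable (x (k + 2)) u := by
    intro u v h
    obtain ⟨⟨s, h1, h2, rfl⟩, -⟩ := exists_of_segment_adj h
    exact segment_reachable (fun t _ _ => hne t (t + 1) (by omega) (by omega) (by omega)) h1 h2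
  -- For `k = 0` the cycle has length four and the segment is empty.
  have h23 : (x 2, x 3) = (x (k + 2), x (k + 3)) ∨ (segment x 2 (k + 2)).Adj (x 2) (x 3) := by
    rcases Nat.eq_zero_or_pos k with rfl | hk
    · exact Or.inl rfl
    · exact Or.inr (segment_adj.2 ⟨⟨2, le_rfl, by omega, rfl⟩, hne 2 3 (by omega) (by omega)
        (by omega)⟩)
  have n01 : x 0 ≠ x 1 := hne _ _ (by omega) (by omega) (by omega)
  have n02 : x 0 ≠ x 2 := hne _ _ (by omega) (by omega) (by omega)
  have n12 : x 1 ≠ x 2 := hne _ _ (by omega) (by omega) (by omega)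
  have n03 : x 0 ≠ x 3 := hne _ _ (by omega) (by omega) (by omega)
  have n13 : x 1 ≠ x 3 := hne _ _ (by omega) (by omega) (by omega)
  have n23 : x 2 ≠ x 3 := hne _ _ (by omega) (by omega) (by omega)
  have n0d : x 0 ≠ x (k + 2) := hne _ _ (by omega) (by omega) (by omega)
  have n0e : x 0 ≠ x (k + 3) := hne _ _ (by omega) (by omega) (by omega)
  have n1d : x 1 ≠ x (k + 2) := hne _ _ (by omega) (by omega) (by omega)
  have n1e : x 1 ≠ x (k + 3) := hne _ _ (by omega) (by omega) (by omega)
  have n2e : x 2 ≠ x (k + 3) := hne _ _ (by omega) (by omega) (by omega)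
  have nde : x (k + 2) ≠ x (k + 3) := hne _ _ (by omega) (by omega) (by omega)
  have hsym := fun u v => (segment x 2 (k + 2)).adj_comm u v
  generalize hP : segment x 2 (k + 2) = P at *
  generalize x 0 = a at *
  generalize x 1 = b at *
  generalize x 2 = c at *
  generalize x 3 = c' at *
  generalize x (k + 2) = d at *
  generalize x (k + 3) = e at *
  clear hne hinj hP
  set U := arcs (P ⊔ edge b c ⊔ edge a e ⊔ edge a b ⊔ edge d e) with hU
  have hUmem : ∀ u v, (u, v) ∈ U ↔ (P ⊔ edge b c ⊔ edge a e ⊔ edge a b ⊔ edge d e).Adj u v := by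
    simp [hU]
  have dbc : 4 ≤ degIn (arcGraph V) U (b, c) := by
    have h3 : ({(b, a), (a, b), (c, b), (c, c')} : Finset (V × V)).card = 4 := by
      simp [*, n01.symm]
    rw [← h3]
    apply card_le_degIn
    rcases h23 with h | h
    · obtain ⟨rfl, rfl⟩ := Prod.mk.inj h
      simp [arcGraph_adj, edge_adj, *, n01.symm, n12.symm, n02.symm]
    · simp [arcGraph_adj, edge_adj, *, n01.symm, n12.symm, n02.symm]
  have dea : 4 ≤ degIn (arcGraph V) U (e, a) := by
    have h3 : ({(a, e), (a, b), (e, d), (d, e)} : Finset (V × V)).card = 4 := by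
      simp [*, nde.symm, n1e.symm]
    rw [← h3]
    apply card_le_degIn
    simp [arcGraph_adj, edge_adj, *, n0d.symm, nde.symm, n0e.symm, n1e.symm]
  have dab : degIn (arcGraph V) U (a, b) ≤ 1 + 2 + 1 := by
    apply degIn_arcs_le
    · simp [edge_adj, n01]
    · refine (Set.ncard_le_ncard (t := {b, e}) ?_ (Set.toFinite _)).trans ((Set.ncard_insert_le _ _).trans
        (by rw [Set.ncard_singleton]))
      intro y hy
      simp only [mem_neighborSet, sup_adj, edge_adj] at hy
      have := fun h => (hseg (u := a) (v := y) h).1 rfl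
      simp only [Set.mem_insert_iff, Set.mem_singleton_iff]
      grind
    · refine (Set.ncard_le_ncard (t := {a, c}) ?_ (Set.toFinite _)).trans ((Set.ncard_insert_le _ _).trans
        (by rw [Set.ncard_singleton]))
      intro y hy
      simp only [mem_neighborSet, sup_adj, edge_adj] at hy
      have := fun h => (hseg (u := b) (v := y) h).2.1 rfl
      simp only [Set.mem_insert_iff, Set.mem_singleton_iff]
      grind
  -- These two nonadjacent neighbors raise the gain of `(a, b)` from 1 to 2. The count is 4 + 1 + 2
  -- ≤ 4 + 4.
  apply SlackColorable.of_pair (u := (b, c)) (u' := (e, a)) (v := (a, b))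
  · simp [hUmem, edge_adj, n12]
  · simp [hUmem, edge_adj, n0e.symm]
  · simp [n1e]
  · simp [arcGraph_adj, n1e, n2e, n01]
  · simp [arcGraph_adj, n01.symm]
  · simp [arcGraph_adj, n0e.symm]
  · omega
  · omega
  · omega
  set g' : V × V → ℕ := fun p => g p + if p = (a, b) then 1 else 0 with hg'
  have s0 := SlackColorable.empty (α := α) (K := arcGraph V) g'
  -- The rest is built in reverse coloring order: `(a, b)` needs only its gain, `(b, a)`, `(e, d)`
  -- and `(d, e)` each use their gain and one neighbor, and `de` then spreads along the path.
  have s1 := s0.insert_of_two_le (a := (a, b)) (by simp) (by simp [hg', hg1])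
  have s2 := s1.insert_of_two_le (a := (b, a)) (by simp [n01.symm]) (by
    have := one_le_degIn (K := arcGraph V) (U := insert (a, b) ∅) (a := (b, a)) (b := (a, b))
      (by simp) (by simp [arcGraph_adj, n01.symm])
    simp only [hg', hg2]; omega)
  have s3 := s2.insert_of_two_le (a := (a, e)) (by simp [n1e.symm, n01]) (by
    have := two_le_degIn (K := arcGraph V) (U := insert (b, a) (insert (a, b) ∅)) (a := (a, e))
      (b := (a, b)) (c := (b, a)) (by simp) (by simp) (by simp [n01])
      (by simp [arcGraph_adj, n1e.symm]) (by simp [arcGraph_adj, n01])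
    omega)
  have s4 := s3.insert_of_two_le (a := (e, d)) (by simp [n1e.symm, n0e.symm]) (by
    have := one_le_degIn (K := arcGraph V) (U := insert (a, e) (insert (b, a) (insert (a, b) ∅)))
      (a := (e, d)) (b := (a, e)) (by simp) (by simp [arcGraph_adj, n0e.symm])
    simp only [hg', hg4]; omega)
  have s5 := s4.insert_of_two_le (a := (d, e)) (by simp [n1d.symm, n0d.symm, nde]) (by
    have := one_le_degIn (K := arcGraph V)
      (U := insert (e, d) (insert (a, e) (insert (b, a) (insert (a, b) ∅))))
      (a := (d, e)) (b := (e, d)) (by simp) (by simp [arcGraph_adj, nde])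
    simp only [hg', hg3]; omega)
  have s6 := s5.union_arcs (H := P) (z := d) (z' := e) (by simp) (by simp) nde hreach
  have hcb : (c, b) ∉ insert (d, e) (insert (e, d) (insert (a, e) (insert (b, a)
      (insert (a, b) (∅ : Finset (V × V)))))) ∪ arcs P := by
    have : ¬ P.Adj c b := fun h => (hseg h).2.2.2.2.1 rfl
    simp [n1e, n1d, n12.symm, n02.symm, this, n01.symm]
  have s7 := s6.insert_of_two_le hcb (by
    have := two_le_degIn (K := arcGraph V) (U := insert (d, e) (insert (e, d) (insert (a, e)
      (insert (b, a) (insert (a, b) ∅)))) ∪ arcs P) (a := (c, b)) (b := (b, a)) (c := (c, c'))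
      (by simp) (by rcases h23 with h | h <;> simp [h]) (by simp [n12])
      (by simp [arcGraph_adj, n12.symm]) (by simp [arcGraph_adj, n13])
    omega)
  convert s7 using 1
  ext ⟨y, z⟩
  simp only [Finset.mem_erase, hUmem, Finset.mem_union, Finset.mem_insert, Finset.notMem_empty,
    mem_arcs, sup_adj, edge_adj, ne_eq, Prod.mk.injEq]
  have hs1 := hseg (u := y) (v := z)
  clear s0 s1 s2 s3 s4 s5 s6 s7 dbc dea dab h23 hcb hg' g' hUmem hU U hseg hreach hsym hg1 hg2 hg3 hg4
  by_cases hyz : P.Adj y z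
  · grind
  · simp only [hyz, false_or, or_false]
    clear hs1 hyz
    grind

/-- In a triangle-free graph of maximum degree three, a cycle `x 0, x 1, …, x (k + 3)` of vertices of
degree three without the chord `x 1 x (k + 2)` lies in a slack-colorable subgraph. -/
theorem exists_slackColorable_of_cycle [Nonempty α] {G : SimpleGraph V}
    (hdeg : ∀ v, (G.neighborSet v).ncard ≤ 3)
    (htri : ∀ u v w, G.Adj u v → G.Adj v w → ¬ G.Adj u w) {x : ℕ → V} {k : ℕ}
    (hinj : ∀ s t, s < k + 4 → t < k + 4 → x s = x t → s = t)
    (hadj : ∀ t, t < k + 3 → G.Adj (x t) (x (t + 1))) (hclose : G.Adj (x (k + 3)) (x 0))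
    (h3 : ∀ t, t < k + 4 → 3 ≤ (G.neighborSet (x t)).ncard)
    (hchord : k = 0 ∨ ¬ G.Adj (x 1) (x (k + 2))) :
    ∃ B ≤ G, B.Adj (x 0) (x 1) ∧ SlackColorable α (arcGraph V) (fun _ => 0) (arcs B) := by
  classical
  have hne : ∀ s t, s < k + 4 → t < k + 4 → s ≠ t → x s ≠ x t :=
    fun s t hs ht h h' => h (hinj s t hs ht h')
  have hcyc := fun g => slackColorable_cycle (α := α) hinj (g := g)
  have hsegG : segment x 2 (k + 2) ≤ G := by
    intro u v h
    obtain ⟨⟨t, h1, h2, h3⟩, -⟩ := segment_adj.1 h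
    have := hadj t (by omega)
    rw [← mem_edgeSet] at this ⊢
    rwa [h3]
  have hseg : ∀ {u v : V}, (segment x 2 (k + 2)).Adj u v → u ≠ x 0 ∧ u ≠ x 1 ∧ u ≠ x (k + 3) ∧
      v ≠ x 0 ∧ v ≠ x 1 ∧ v ≠ x (k + 3) := by
    intro u v h
    obtain ⟨⟨s, h1, h2, rfl⟩, ⟨t, h3, h4, rfl⟩⟩ := exists_of_segment_adj h
    refine ⟨?_, ?_, ?_, ?_, ?_, ?_⟩ <;> apply hne <;> omega
  have hreach : ∀ u v, (segment x 2 (k + 2)).Adj u v →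
      (segment x 2 (k + 2)).Reachable (x (k + 2)) u := by
    intro u v h
    obtain ⟨⟨s, h1, h2, rfl⟩, -⟩ := exists_of_segment_adj h
    exact segment_reachable (fun t _ _ => hne t (t + 1) (by omega) (by omega) (by omega)) h1 h2
  have hreach2 : (segment x 2 (k + 2)).Reachable (x (k + 2)) (x 2) :=
    segment_reachable (fun t _ _ => hne t (t + 1) (by omega) (by omega) (by omega)) le_rfl
      (by omega)
  -- `d'` is the predecessor of `x (k + 2)` on the cycle, namely `x 1` when the segment is empty.
  have hd : ∃ d', (∀ v, (segment x 2 (k + 2)).Adj (x (k + 2)) v → v = d') ∧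
      ((segment x 2 (k + 2)).Adj (x (k + 2)) d' ∨ d' = x 1 ∧ x (k + 2) = x 2) ∧
      (x 2 = x (k + 2) → d' = x 1) := by
    rcases Nat.eq_zero_or_pos k with rfl | hk
    · refine ⟨x 1, fun v hv => ?_, Or.inr ⟨rfl, rfl⟩, fun _ => rfl⟩
      obtain ⟨⟨t, h1, h2, -⟩, -⟩ := segment_adj.1 hv
      omega
    · refine ⟨x (k + 1), fun v hv => ?_, Or.inl (segment_adj.2 ⟨⟨k + 1, by omega, by omega,
        Sym2.eq_swap⟩, hne _ _ (by omega) (by omega) (by omega)⟩), fun h =>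
          absurd h (hne _ _ (by omega) (by omega) (by omega))⟩
      obtain ⟨⟨t, h1, h2, h3⟩, -⟩ := segment_adj.1 hv
      rw [Sym2.eq_iff] at h3
      rcases h3 with ⟨h, -⟩ | ⟨h, h'⟩
      · have := hinj _ _ (by omega) (by omega) h
        omega
      · have := hinj _ _ (by omega) (by omega) h
        have e : t = k + 1 := by omega
        rw [h', e]
  have hchord' : x 2 = x (k + 2) ∨ ¬ G.Adj (x 1) (x (k + 2)) := by
    rcases hchord with rfl | h
    · exact Or.inl rfl
    · exact Or.inr h
  have gab := hadj 0 (by omega)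
  have gbc := hadj 1 (by omega)
  have gde := hadj (k + 2) (by omega)
  have n02 : x 0 ≠ x 2 := hne _ _ (by omega) (by omega) (by omega)
  have n0d : x 0 ≠ x (k + 2) := hne _ _ (by omega) (by omega) (by omega)
  have n1d : x 1 ≠ x (k + 2) := hne _ _ (by omega) (by omega) (by omega)
  have n1e : x 1 ≠ x (k + 3) := hne _ _ (by omega) (by omega) (by omega)
  have n2e : x 2 ≠ x (k + 3) := hne _ _ (by omega) (by omega) (by omega)
  have d0 := h3 0 (by omega)
  have d1 := h3 1 (by omega)
  have dd := h3 (k + 2) (by omega)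
  have de := h3 (k + 3) (by omega)
  have hsym := fun u v => (segment x 2 (k + 2)).adj_comm u v
  simp only [zero_add, show 1 + 1 = 2 from rfl, show k + 2 + 1 = k + 3 from rfl] at gab gbc gde
  generalize segment x 2 (k + 2) = P at *
  generalize x 0 = a at *
  generalize x 1 = b at *
  generalize x 2 = c at *
  generalize x (k + 2) = d at *
  generalize x (k + 3) = e at *
  clear hne hinj hadj h3 hchord
  obtain ⟨d', hd1, hd2, hd3⟩ := hd
  -- These are the third neighbors of `a`, `b`, `d`, `e`. Triangle-freeness and the missing chord
  -- `bd` make the four third edges pairwise distinct, although their outer ends may coincide or lie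
  -- on the cycle.
  obtain ⟨ma, gma, hma1, hma2⟩ := exists_adj_ne_ne d0 b e
  obtain ⟨mb, gmb, hmb1, hmb2⟩ := exists_adj_ne_ne d1 a c
  obtain ⟨md, gmd, hmd1, hmd2⟩ := exists_adj_ne_ne dd e d'
  obtain ⟨me, gme, hme1, hme2⟩ := exists_adj_ne_ne de d a
  have hde : ¬ P.Adj d e := fun h => (hseg h).2.2.2.2.2 rfl
  have hmdb : md ≠ b := by
    rintro rfl
    rcases hchord' with h | h
    · exact hmd2 (hd3 h).symm
    · exact h gmd.symm
  have hmbd : mb ≠ d := by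
    rintro rfl
    rcases hchord' with h | h
    · exact hmb2 h.symm
    · exact h gmb
  have nad : ¬ G.Adj a d := fun h => htri _ _ _ h gde hclose.symm
  have nbe : ¬ G.Adj b e := fun h => htri _ _ _ gab h hclose.symm
  have hmda : md ≠ a := by rintro rfl; exact nad gmd.symm
  have hmad : ma ≠ d := by rintro rfl; exact nad gma
  have hmeb : me ≠ b := by rintro rfl; exact nbe gme.symm
  have hmbe : mb ≠ e := by rintro rfl; exact nbe gmb
  have hmde : md ≠ me := by rintro rfl; exact htri _ _ _ gde gme gmd
  have hmab : ma ≠ mb := by rintro rfl; exact htri _ _ _ gab gmb gma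
  have hPa : ∀ v, ¬ P.Adj a v := fun v h => (hseg h).1 rfl
  have hPb : ∀ v, ¬ P.Adj b v := fun v h => (hseg h).2.1 rfl
  have hPe : ∀ v, ¬ P.Adj e v := fun v h => (hseg h).2.2.1 rfl
  have eq1 : P ⊔ edge b c ⊔ edge a e ⊔ edge d e ⊔ edge d md ⊔ edge e me ⊔ edge a b
      = P ⊔ edge b c ⊔ edge a e ⊔ edge a b ⊔ edge d e ⊔ edge d md ⊔ edge e me := by
    ac_rfl
  have edge_le : ∀ {u v : V}, G.Adj u v → edge u v ≤ G := fun {u v} h => by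
    rw [edge_le_iff]; exact Or.inr h
  have hle : P ⊔ edge b c ⊔ edge a e ⊔ edge d e ⊔ edge d md ⊔ edge e me ⊔ edge a b ⊔
      edge a ma ⊔ edge b mb ≤ G := by
    simp only [sup_le_iff]
    exact ⟨⟨⟨⟨⟨⟨⟨⟨hsegG, edge_le gbc⟩, edge_le hclose.symm⟩, edge_le gde⟩, edge_le gmd⟩,
      edge_le gme⟩, edge_le gab⟩, edge_le gma⟩, edge_le gmb⟩
  have hdegle : ∀ {H : SimpleGraph V}, H ≤ G → ∀ v, (H.neighborSet v).ncard ≤ 3 := fun hH v =>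
    (Set.ncard_le_ncard (neighborSet_mono hH v) (Set.toFinite _)).trans (hdeg v)
  refine ⟨_, hle, by simp [edge_adj, gab.ne], ?_⟩
  -- Gain first at `ab`, keeping the third edges of `d` and `e` uncolored for a second gain at `de`.
  apply SlackColorable.of_sup_edges (e := e) (c := c) gab.ne gma.ne' hma1 hmb1 gmb.ne' hmab
  · simp only [sup_adj, edge_adj]; grind
  · simp only [sup_adj, edge_adj]; grind
  · simp only [sup_adj, edge_adj]; grind
  · simp [edge_adj, hclose.ne']
  · simp [edge_adj, gbc.ne]
  · generalize hH : P ⊔ edge b c ⊔ edge a e ⊔ edge d e ⊔ edge d md ⊔ edge e me = H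
    have rPH : P ≤ H := by
      rw [← hH]; simp only [sup_assoc]; exact le_sup_left
    have r1 : H.Reachable a e := Adj.reachable (by simp [← hH, edge_adj, hclose.ne'])
    have r2 : H.Reachable a d := r1.trans (Adj.reachable (by simp [← hH, edge_adj, gde.ne']))
    have r3 : H.Reachable a c := r2.trans (hreach2.mono rPH)
    have r4 : H.Reachable a b := r3.trans (Adj.reachable (by simp [← hH, edge_adj, gbc.ne']))
    have r5 : H.Reachable a md := r2.trans (Adj.reachable (by simp [← hH, edge_adj, gmd.ne]))
    have r6 : H.Reachable a me := r1.trans (Adj.reachable (by simp [← hH, edge_adj, gme.ne]))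
    have r7 : ∀ u v, P.Adj u v → H.Reachable a u := fun u v h =>
      r2.trans ((hreach u v h).mono rPH)
    intro u v h
    simp only [← hH, sup_adj, edge_adj] at h
    rcases h with ((((h | h) | h) | h) | h) | h
    · exact r7 u v h
    all_goals obtain ⟨⟨rfl, -⟩ | ⟨rfl, -⟩, -⟩ := h <;> first | assumption | rfl
  · exact hdegle hle
  · rfl
  · rfl
  rw [eq1]
  apply SlackColorable.of_sup_edges (e := d') (c := a) gde.ne gmd.ne' hmd1 hme1 gme.ne' hmde
  · simp only [sup_adj, edge_adj]; grind
  · simp only [sup_adj, edge_adj]; grind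
  · simp only [sup_adj, edge_adj]; grind
  · rcases hd2 with h | ⟨rfl, rfl⟩
    · simp [h]
    · simp [edge_adj, gbc.ne']
  · simp [edge_adj, hclose.ne]
  · generalize hH : P ⊔ edge b c ⊔ edge a e ⊔ edge a b = H
    have rPH : P ≤ H := by
      rw [← hH]; simp only [sup_assoc]; exact le_sup_left
    have r3 : H.Reachable d c := hreach2.mono rPH
    have r4 : H.Reachable d b := r3.trans (Adj.reachable (by simp [← hH, edge_adj, gbc.ne']))
    have r5 : H.Reachable d a := r4.trans (Adj.reachable (by simp [← hH, edge_adj, gab.ne']))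
    have r6 : H.Reachable d e := r5.trans (Adj.reachable (by simp [← hH, edge_adj, hclose.ne']))
    have r7 : ∀ u v, P.Adj u v → H.Reachable d u := fun u v h => (hreach u v h).mono rPH
    intro u v h
    simp only [← hH, sup_adj, edge_adj] at h
    rcases h with ((h | h) | h) | h
    · exact r7 u v h
    all_goals obtain ⟨⟨rfl, -⟩ | ⟨rfl, -⟩, -⟩ := h <;> assumption
  · rw [← eq1]
    exact hdegle (le_sup_left.trans (le_sup_left.trans hle))
  · simp [n0d.symm, n1d.symm]
  · simp [hclose.ne, n1e.symm]
  · apply hcyc <;> simp [n0d, n1d, n1e, n0d.symm, n1d.symm, n1e.symm, hclose.ne, hclose.ne',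
      gab.ne', gde.ne, gde.ne']

end CycleBlock

end IncidenceChoosability

namespace IncidenceChoosability

/-! ### Existence of a core -/

section MinDegree

open SimpleGraph

variable {V : Type*} [Fintype V] {α : Type*}

/-- A walk without backtracking in a finite graph runs around a cycle. -/
theorem exists_cycle_of_forall_exists_adj_ne {G : SimpleGraph V} {W : Set V} (hW : W.Nonempty)
    (hback : ∀ w ∈ W, ∀ p, ∃ q ∈ W, G.Adj w q ∧ q ≠ p) :
    ∃ (n : ℕ) (x : ℕ → V), 3 ≤ n ∧ (∀ t, x t ∈ W) ∧
      (∀ s t, s < n → t < n → x s = x t → s = t) ∧ (∀ t, G.Adj (x t) (x (t + 1))) ∧ x n = x 0 := by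
  classical
  obtain ⟨w0, hw0⟩ := hW
  choose f hfW hfadj hfne using hback
  -- A state is the previous and the current vertex. The first state repeats `w0`, which forbids
  -- nothing because an edge never returns to its own end.
  let next : V × W → V × W := fun p => (p.2, ⟨f p.2 p.2.2 p.1, hfW _ _ _⟩)
  let state : ℕ → V × W := fun t => next^[t] (w0, ⟨w0, hw0⟩)
  have hstate : ∀ t, state (t + 1) = next (state t) := fun t =>
    Function.iterate_succ_apply' next t _
  let z : ℕ → V := fun t => (state t).2
  have hz : ∀ t, z (t + 1) = f (z t) (state t).2.2 (state t).1 := fun t => by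
    change ((state (t + 1)).2 : V) = _
    rw [hstate]
  have hzadj : ∀ t, G.Adj (z t) (z (t + 1)) := fun t => by rw [hz]; exact hfadj _ _ _
  have hz2 : ∀ t, z (t + 2) ≠ z t := fun t => by
    rw [hz (t + 1)]
    have : (state (t + 1)).1 = z t := by rw [hstate]
    rw [← this]
    exact hfne _ _ _
  -- The shortest return time makes the closed stretch of the walk injective; it is at least three
  -- since there are no loops and no backtracking.
  have hex : ∃ n, 0 < n ∧ ∃ s, z s = z (s + n) := by
    obtain ⟨s, t, hne, hst⟩ := Finite.exists_ne_map_eq_of_infinite z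
    rcases Nat.lt_or_gt_of_ne hne with h | h
    · exact ⟨t - s, by omega, s, by rw [hst]; congr 1; omega⟩
    · exact ⟨s - t, by omega, t, by rw [← hst]; congr 1; omega⟩
  obtain ⟨hpos, s, hs⟩ := Nat.find_spec hex
  have hmin := fun m => Nat.find_min (H := hex) (m := m)
  generalize Nat.find hex = n at hpos hs hmin
  refine ⟨n, fun t => z (s + t), ?_, fun t => (state (s + t)).2.2, ?_, fun t => hzadj (s + t),
    hs.symm⟩
  · by_contra hlt
    have : n = 1 ∨ n = 2 := by omega
    rcases this with rfl | rfl
    · exact (hzadj s).ne hs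
    · exact hz2 s hs.symm
  · intro i j hi hj hij
    by_contra hne
    rcases Nat.lt_or_gt_of_ne hne with h | h
    · exact hmin (j - i) (by omega) ⟨by omega, s + i, by
        simp only at hij; rw [hij]; congr 1; omega⟩
    · exact hmin (i - j) (by omega) ⟨by omega, s + j, by
        simp only at hij; rw [← hij]; congr 1; omega⟩

/-- The triangle is the core, and it spreads to all edges. -/
theorem slackColorable_arcs_of_triangle [Nonempty α] {G : SimpleGraph V} {a b c : V}
    (hab : G.Adj a b) (hbc : G.Adj b c) (hac : G.Adj a c)
    (hreach : ∀ x y, G.Adj x y → G.Reachable a x) :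
    SlackColorable α (arcGraph V) (fun _ => 0) (arcs G) := by
  classical
  have h := (slackColorable_triangle (α := α) (g := fun _ => 0) hab.ne hbc.ne hac.ne).union_arcs
    (z := a) (z' := b) (by simp) (by simp) hab.ne hreach
  convert h using 1
  rw [eq_comm, Finset.union_eq_right]
  intro p hp
  simp only [Finset.mem_insert, Finset.mem_singleton] at hp
  rcases hp with rfl | rfl | rfl | rfl | rfl | rfl <;>
    simp [hab, hab.symm, hac, hac.symm, hbc, hbc.symm]

/-- A graph of maximum degree three whose edges are connected, with a nonempty set `W` of vertices
of degree three that spans a graph of minimum degree two, is slack colorable. -/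
theorem slackColorable_arcs [Nonempty α] {G : SimpleGraph V}
    (hdeg : ∀ v, (G.neighborSet v).ncard ≤ 3) {W : Set V} (hW : W.Nonempty)
    (h3 : ∀ w ∈ W, 3 ≤ (G.neighborSet w).ncard)
    (hback : ∀ w ∈ W, ∀ p, ∃ q ∈ W, G.Adj w q ∧ q ≠ p)
    (hreach : ∀ w ∈ W, ∀ x y, G.Adj x y → G.Reachable w x) :
    SlackColorable α (arcGraph V) (fun _ => 0) (arcs G) := by
  classical
  by_cases htri : ∃ a b c, G.Adj a b ∧ G.Adj b c ∧ G.Adj a c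
  · obtain ⟨a, b, c, hab, hbc, hac⟩ := htri
    obtain ⟨w, hw⟩ := hW
    exact slackColorable_arcs_of_triangle hab hbc hac fun x y h =>
      (hreach w hw a b hab).symm.trans (hreach w hw x y h)
  have htri' : ∀ u v w, G.Adj u v → G.Adj v w → ¬ G.Adj u w := fun u v w h1 h2 h3 =>
    htri ⟨u, v, w, h1, h2, h3⟩
  obtain ⟨n, x, hn, hxW, hinj, hadj, hclose⟩ := exists_cycle_of_forall_exists_adj_ne hW hback
  have hn4 : n ≠ 3 := by
    rintro rfl
    have h20 := hadj 2
    rw [show 2 + 1 = 3 from rfl, hclose] at h20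
    exact htri' _ _ _ (hadj 0) (hadj 1) h20.symm
  obtain ⟨k, rfl⟩ : ∃ k, n = k + 4 := ⟨n - 4, by omega⟩
  have hlast : G.Adj (x (k + 3)) (x 0) := by
    have := hadj (k + 3)
    rwa [show k + 3 + 1 = k + 4 from rfl, hclose] at this
  obtain ⟨B, hBG, hB01, hB⟩ : ∃ B ≤ G, B.Adj (x 0) (x 1) ∧
      SlackColorable α (arcGraph V) (fun _ => 0) (arcs B) := by
    by_cases hchord : k = 0 ∨ ¬ G.Adj (x 1) (x (k + 2))
    · exact exists_slackColorable_of_cycle hdeg htri' hinj (fun t _ => hadj t) hlast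
        (fun t _ => h3 _ (hxW t)) hchord
    · push Not at hchord
      -- The chord closes the 4-cycle `x 0, x 1, x (k + 2), x (k + 3)`, for which the chord
      -- condition is void.
      let i : ℕ → ℕ := fun t => if t ≤ 1 then t else k + t
      have hi : ∀ t, t < 4 → i t < k + 4 := fun t ht => by
        simp only [i]; split_ifs <;> omega
      refine exists_slackColorable_of_cycle (x := fun t => x (i t)) (k := 0) hdeg htri' ?_ ?_ ?_
        (fun t _ => h3 _ (hxW _)) (Or.inl rfl)
      · intro s t hs ht hst
        have := hinj _ _ (hi s (by omega)) (hi t (by omega)) hst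
        simp only [i] at this
        split_ifs at this <;> omega
      · intro t ht
        have ht' : t = 0 ∨ t = 1 ∨ t = 2 := by omega
        rcases ht' with rfl | rfl | rfl
        · simpa [i] using hadj 0
        · simpa [i] using hchord.2
        · simpa [i] using hadj (k + 2)
      · simpa [i] using hlast
  have h := hB.union_arcs (H := G) (z := x 0) (z' := x 1) (by simpa using hB01)
    (by simpa using hB01.symm) hB01.ne (hreach _ (hxW 0))
  convert h using 1
  rw [eq_comm, Finset.union_eq_right]
  intro p hp
  rw [mem_arcs] at hp ⊢
  exact hBG hp

end MinDegree

end IncidenceChoosability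

namespace IncidenceChoosability

/-! ### From incidences to arcs -/

section Incidences

open SimpleGraph

variable {V α : Type*} {G : SimpleGraph V}

/-- The arc `(u, v)` of the incidence of `u` with `uv`. -/
noncomputable def Incidence.arc (i : Incidence G) : V × V := (i.vertex, Sym2.Mem.other i.2.2)

theorem Incidence.mk_arc (i : Incidence G) : s(i.arc.1, i.arc.2) = i.edge :=
  Sym2.other_spec i.2.2

theorem Incidence.arc_adj (i : Incidence G) : G.Adj i.arc.1 i.arc.2 := by
  rw [← mem_edgeSet, i.mk_arc]
  exact i.2.1

theorem Incidence.arc_injective : Function.Injective (Incidence.arc (G := G)) := by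
  intro i j h
  refine Subtype.ext (Prod.ext (show i.arc.1 = j.arc.1 by rw [h]) ?_)
  have h1 := i.mk_arc
  rw [h] at h1
  exact h1.symm.trans j.mk_arc

theorem Incidence.Adjacent.arcGraph_adj {i j : Incidence G} (h : i.Adjacent j) :
    (arcGraph V).Adj i.arc j.arc := by
  refine ⟨fun h' => h.1 (Incidence.arc_injective h'), ?_⟩
  have hi := i.mk_arc
  have hj := j.mk_arc
  have h1 : i.arc.1 = i.vertex := rfl
  have h2 : j.arc.1 = j.vertex := rfl
  rcases h.2 with h | h | h | h
  · exact Or.inl h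
  · rw [← hi, ← hj, Sym2.eq_iff] at h
    rcases h with h | h
    · exact Or.inl h.1
    · exact Or.inr (Or.inl h.2)
  · rw [← hi, ← h1, ← h2, Sym2.eq_iff] at h
    rcases h with h | h
    · exact Or.inr (Or.inl h.2.symm)
    · exact Or.inl h.2.symm
  · rw [← hj, ← h1, ← h2, Sym2.eq_iff] at h
    rcases h with h | h
    · exact Or.inl h.1
    · exact Or.inr (Or.inr h.1.symm)

open scoped Classical in
/-- The lists of the incidences as lists of arcs. -/
noncomputable def arcList (L : Incidence G → Finset α) : V × V → Finset α := fun p =>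
  if h : G.Adj p.1 p.2 then L ⟨(p.1, s(p.1, p.2)), h, Sym2.mem_mk_left _ _⟩ else ∅

theorem arcList_arc (L : Incidence G → Finset α) (i : Incidence G) : arcList L i.arc = L i := by
  rw [arcList, dif_pos i.arc_adj]
  congr 1
  exact Subtype.ext (Prod.ext rfl i.mk_arc)

theorem card_arcList {L : Incidence G → Finset α} {k : ℕ} (hL : ∀ i, (L i).card = k) {p : V × V}
    (hp : G.Adj p.1 p.2) : (arcList L p).card = k := by
  rw [arcList, dif_pos hp]
  exact hL _

variable [Fintype V]

theorem ListColorable.exists_isListColoring {L : Incidence G → Finset α} {A : V × V → Finset α}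
    (hA : ∀ i : Incidence G, A i.arc ⊆ L i) (h : ListColorable (arcGraph V) (arcs G) A) :
    ∃ φ : Incidence G → α, IsListColoring L φ ∧ ∀ i, φ i ∈ A i.arc := by
  obtain ⟨φ, h1, h2⟩ := h
  have hmem : ∀ i : Incidence G, i.arc ∈ arcs G := fun i => by simpa using i.arc_adj
  exact ⟨fun i => φ i.arc, ⟨fun i => hA i (h1 _ (hmem i)), fun i j hij =>
    h2 _ (hmem i) _ (hmem j) hij.arcGraph_adj⟩, fun i => h1 _ (hmem i)⟩

theorem isChoosable_of_slackColorable (hdeg : ∀ v, (G.neighborSet v).ncard ≤ 3)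
    {L : Incidence G → Finset α} (hL : ∀ i, (L i).card = 6)
    (h : SlackColorable α (arcGraph V) (fun _ => 0) (arcs G)) : IsChoosable L := by
  obtain ⟨φ, hφ, -⟩ := ListColorable.exists_isListColoring (L := L) (A := arcList L)
    (fun i => (arcList_arc L i).subset) (h _ fun b hb => by
      have hb' : G.Adj b.1 b.2 := by simpa using hb
      rw [card_arcList hL hb']
      exact degIn_arcs_le (k := 2) hb' (hdeg _) (hdeg _))
  exact ⟨φ, hφ⟩

/-- The arcs of `e` get the singleton lists `{c₁}`, `{c₂}` and are colored first. Coloring them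
keeps the slack of all others, and only the arcs of `G - e` remain. -/
theorem isFreelyChoosable_of_slackColorable (hdeg : ∀ v, (G.neighborSet v).ncard ≤ 3)
    {L : Incidence G → Finset α} (hL : ∀ i, (L i).card = 6) {e : Sym2 V}
    (h : SlackColorable α (arcGraph V) (fun _ => 0) (arcs (G.deleteEdges {e}))) :
    IsFreelyChoosable L e := by
  classical
  intro i j hij hi hj c₁ hc₁ c₂ hc₂ hc
  have hpq : i.arc ≠ j.arc := fun h => hij (Incidence.arc_injective h)
  have ei := i.mk_arc
  have ej := j.mk_arc
  rw [hi] at ei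
  rw [hj] at ej
  set A : V × V → Finset α :=
    Function.update (Function.update (arcList L) i.arc {c₁}) j.arc {c₂} with hA
  have hAi : A i.arc = {c₁} := by simp [hA, hpq]
  have hAj : A j.arc = {c₂} := by simp [hA]
  have hi' : i.arc ∈ arcs G := by simpa using i.arc_adj
  have hj' : j.arc ∈ (arcs G).erase i.arc := by simpa [hpq.symm] using j.arc_adj
  have hcol : ListColorable (arcGraph V) (arcs G) A := by
    refine .of_erase (a := i.arc) (c := c₁) (by simp [hAi])
      (.of_erase (a := j.arc) (c := c₂) ?_ ?_)
    · unfold reduceLists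
      split_ifs <;> simp [hAj, hc.symm]
    · have harcs : ((arcs G).erase i.arc).erase j.arc = arcs (G.deleteEdges {e}) := by
        ext p
        have hswap : i.arc = j.arc.swap := by
          have := ei.trans ej.symm
          rw [Sym2.eq_iff] at this
          rcases this with h | h
          · exact absurd (Prod.ext h.1 h.2) hpq
          · exact Prod.ext h.1 h.2
        simp only [Finset.mem_erase, mem_arcs, deleteEdges_adj, Set.mem_singleton_iff, ne_eq,
          ← ej, Sym2.eq_iff]
        rw [hswap]
        simp only [Prod.ext_iff, Prod.fst_swap, Prod.snd_swap]
        tauto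
      rw [harcs]
      apply h
      intro b hb
      rw [← harcs] at hb ⊢
      simp only [Finset.mem_erase, mem_arcs] at hb
      apply slack_reduceLists hj'
      apply slack_reduceLists hi'
      rw [show A b = arcList L b by simp [hA, hb.1, hb.2.1], card_arcList hL hb.2.2]
      exact degIn_arcs_le (k := 2) hb.2.2 (hdeg _) (hdeg _)
  obtain ⟨φ, hφ, hφA⟩ := hcol.exists_isListColoring (L := L) (fun k => by
    by_cases hki : k.arc = i.arc
    · obtain rfl := Incidence.arc_injective hki
      simpa [hAi] using hc₁
    by_cases hkj : k.arc = j.arc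
    · obtain rfl := Incidence.arc_injective hkj
      simpa [hAj] using hc₂
    rw [show A k.arc = arcList L k.arc by simp [hA, hki, hkj], arcList_arc])
  refine ⟨φ, hφ, ?_, ?_⟩
  · simpa [hAi] using hφA i
  · simpa [hAj] using hφA j

end Incidences

/-! ### Cores after deleting an edge -/

section Deletion

open SimpleGraph

variable {V α : Type*} [Fintype V] [Nonempty α] {G : SimpleGraph V}

theorem ncard_neighborSet_le_of_le {H : SimpleGraph V} (hH : H ≤ G) {k : ℕ}
    (hdeg : ∀ v, (G.neighborSet v).ncard ≤ k) (v : V) : (H.neighborSet v).ncard ≤ k :=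
  (Set.ncard_le_ncard (neighborSet_mono hH v) (Set.toFinite _)).trans (hdeg v)

/-- Deleting an edge that is not a bridge and avoids a triangle at one end. -/
theorem slackColorable_arcs_deleteEdges_of_triangle (hconn : G.Connected) {u v a b c : V}
    (huv : (G.deleteEdges {s(u, v)}).Reachable u v) (hab : G.Adj a b) (hbc : G.Adj b c)
    (hac : G.Adj a c) (hua : u ≠ a) (hub : u ≠ b) (huc : u ≠ c) :
    SlackColorable α (arcGraph V) (fun _ => 0) (arcs (G.deleteEdges {s(u, v)})) := by
  have hH : (G.deleteEdges {s(u, v)}).Connected :=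
    hconn.connected_delete_edge_of_not_isBridge fun h => isBridge_iff.1 h huv
  have key : ∀ {p q : V}, G.Adj p q → u ≠ p → u ≠ q → (G.deleteEdges {s(u, v)}).Adj p q := by
    intro p q hpq hp hq
    refine deleteEdges_adj.2 ⟨hpq, fun h => ?_⟩
    rw [Set.mem_singleton_iff, Sym2.eq_iff] at h
    rcases h with h | h
    · exact hp h.1.symm
    · exact hq h.2.symm
  exact slackColorable_arcs_of_triangle (key hab hua hub) (key hbc hub huc) (key hac hua huc)
    fun x y _ => hH.preconnected _ _

/-- Deleting a pendent edge from a graph whose other vertices have degree three. -/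
theorem slackColorable_arcs_deleteEdges_of_pendent (hconn : G.Connected) {q x : V}
    (hqx : G.Adj q x) (hq : ∀ y, G.Adj q y → y = x)
    (h3 : ∀ v, v ≠ q → (G.neighborSet v).ncard = 3) :
    SlackColorable α (arcGraph V) (fun _ => 0) (arcs (G.deleteEdges {s(q, x)})) := by
  classical
  have hdeg : ∀ v, (G.neighborSet v).ncard ≤ 3 := by
    intro v
    by_cases hv : v = q
    · subst hv
      calc (G.neighborSet v).ncard ≤ ({x} : Set V).ncard :=
            Set.ncard_le_ncard (fun y hy => hq y hy) (Set.toFinite _)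
        _ ≤ 3 := by rw [Set.ncard_singleton]; omega
    · exact (h3 v hv).le
  have hadj : ∀ {w y : V}, w ≠ q → w ≠ x → ((G.deleteEdges {s(q, x)}).Adj w y ↔ G.Adj w y) := by
    intro w y hwq hwx
    refine deleteEdges_adj.trans ⟨fun h => h.1, fun h => ⟨h, fun h' => ?_⟩⟩
    rw [Set.mem_singleton_iff, Sym2.eq_iff] at h'
    rcases h' with h' | h'
    · exact hwq h'.1
    · exact hwx h'.1
  have hG3 : ∀ w, w ≠ q → 3 ≤ (G.neighborSet w).ncard := fun w hw => (h3 w hw).ge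
  -- Only `q` and `x` lose degree. A vertex of `W` is not adjacent to `q`, so of its three neighbors
  -- at least two lie in `W`.
  refine slackColorable_arcs (W := {w | w ≠ q ∧ w ≠ x})
    (ncard_neighborSet_le_of_le (deleteEdges_le _) hdeg) ?_ ?_ ?_ ?_
  · obtain ⟨m, hm, hmq, -⟩ := exists_adj_ne_ne (hG3 x hqx.ne') q q
    exact ⟨m, hmq, hm.ne'⟩
  · rintro w ⟨hwq, hwx⟩
    rw [show (G.deleteEdges {s(q, x)}).neighborSet w = G.neighborSet w from
      Set.ext fun y => hadj hwq hwx]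
    exact hG3 w hwq
  · rintro w ⟨hwq, hwx⟩ p
    obtain ⟨m, hm, hmp, hmx⟩ := exists_adj_ne_ne (hG3 w hwq) p x
    exact ⟨m, ⟨fun h => hwx (hq w (h ▸ hm.symm)), hmx⟩, (hadj hwq hwx).2 hm, hmp⟩
  · rintro w ⟨hwq, -⟩ y z hyz
    have hyq : y ≠ q := by
      rintro rfl
      obtain ⟨h1, h2⟩ := deleteEdges_adj.1 hyz
      obtain rfl := hq z h1
      exact h2 rfl
    have hq1 : G.degree q = 1 := by
      rw [degree_eq_one_iff_existsUnique_adj]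
      exact ⟨x, hqx, hq⟩
    have hc := hconn.induce_compl_singleton_of_degree_eq_one hq1
    let f : G.induce ({q}ᶜ : Set V) →g G.deleteEdges {s(q, x)} :=
      { toFun := Subtype.val
        map_rel' := by
          rintro ⟨a, ha⟩ ⟨b, hb⟩ hab
          refine deleteEdges_adj.2 ⟨hab, fun h => ?_⟩
          rw [Set.mem_singleton_iff, Sym2.eq_iff] at h
          rcases h with h | h
          · exact ha h.1
          · exact hb h.2 }
    exact (hc.preconnected ⟨w, hwq⟩ ⟨y, hyq⟩).map f

end Deletion

/-! ### Degrees and cycle-trees -/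

section Decomposition

open SimpleGraph

variable {V : Type*} {G : SimpleGraph V} {E₁ E₂ : Set (Sym2 V)}

/-- Each vertex has one matching edge, plus two edges of `E₂` or none. -/
theorem IsOneTwoDecomposition.ncard_neighborSet [Finite V] (h : IsOneTwoDecomposition G E₁ E₂)
    (v : V) : (G.neighborSet v).ncard = 3 ∨ (G.neighborSet v).ncard = 1 := by
  obtain ⟨w, ⟨hvw, hw1⟩, hw⟩ := h.oneFactor.1 (h.oneFactor.2 v)
  have hmem : ∀ y, G.Adj v y ↔ y = w ∨ (edgeInduced G E₂).Adj v y := by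
    intro y
    constructor
    · intro hy
      have : s(v, y) ∈ E₁ ∪ E₂ := by rw [h.union_eq]; exact hy
      rcases this with h1 | h2
      · exact Or.inl (hw y ⟨hy, h1⟩)
      · exact Or.inr ⟨hy, h2⟩
    · rintro (rfl | h)
      · exact hvw
      · exact h.1
  have hset : G.neighborSet v = insert w ((edgeInduced G E₂).neighborSet v) := Set.ext hmem
  have hw2 : w ∉ (edgeInduced G E₂).neighborSet v := fun h' =>
    Set.disjoint_left.1 h.disjoint hw1 h'.2
  rw [hset, Set.ncard_insert_of_notMem hw2 (Set.toFinite _)]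
  by_cases hv : v ∈ (edgeInduced G E₂).verts
  · exact Or.inl (by rw [h.twoRegular v hv])
  · right
    have : (edgeInduced G E₂).neighborSet v = ∅ :=
      Set.eq_empty_iff_forall_notMem.2 fun y hy => hv ((edgeInduced G E₂).edge_vert hy)
    rw [this, Set.ncard_empty]

theorem CycleOf.mem_vertexSet {C : CycleOf G E₂} {u : V} :
    u ∈ C.vertexSet ↔ ∃ h : u ∈ (edgeInduced G E₂).verts,
      (edgeInduced G E₂).coe.connectedComponentMk ⟨u, h⟩ = C := by
  simp [CycleOf.vertexSet, ConnectedComponent.mem_supp_iff]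

theorem CycleOf.eq_of_mem {C D : CycleOf G E₂} {u : V} (hC : u ∈ C.vertexSet)
    (hD : u ∈ D.vertexSet) : C = D := by
  obtain ⟨h, rfl⟩ := CycleOf.mem_vertexSet.1 hC
  obtain ⟨_, rfl⟩ := CycleOf.mem_vertexSet.1 hD
  rfl

theorem CycleOf.mem_of_adj {C : CycleOf G E₂} {u v : V} (hu : u ∈ C.vertexSet)
    (huv : (edgeInduced G E₂).Adj u v) : v ∈ C.vertexSet := by
  obtain ⟨h, rfl⟩ := CycleOf.mem_vertexSet.1 hu
  refine CycleOf.mem_vertexSet.2 ⟨(edgeInduced G E₂).edge_vert huv.symm, ?_⟩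
  exact ConnectedComponent.sound (Adj.reachable (G := (edgeInduced G E₂).coe) huv.symm)

/-- Two vertices of a cycle are connected in every graph that contains the edges of the cycles. -/
theorem CycleOf.reachable {C : CycleOf G E₂} {H : SimpleGraph V} {u v : V}
    (hH : ∀ a b, (edgeInduced G E₂).Adj a b → H.Adj a b) (hu : u ∈ C.vertexSet)
    (hv : v ∈ C.vertexSet) : H.Reachable u v := by
  obtain ⟨h, rfl⟩ := CycleOf.mem_vertexSet.1 hu
  obtain ⟨h', heq⟩ := CycleOf.mem_vertexSet.1 hv
  let f : (edgeInduced G E₂).coe →g H := ⟨Subtype.val, fun {a b} hab => hH _ _ hab⟩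
  exact ((ConnectedComponent.exact heq).symm).map f

variable {m : ℕ} {C : Fin (m + 1) ≃ CycleOf G E₂} {T : SimpleGraph (CycleOf G E₂)} {GT : G.Subgraph}

/-- An edge of a cycle-tree between a cycle and the root cycle is a cut edge. -/
theorem isCutEdge_of_adj (hT : IsDFSTree (cycleGraph G E₂) T C)
    (hGT : IsCycleTreeWithStructure T GT) {j : Fin (m + 1)} (hj : j ≠ 0) {u v : V}
    (hu : u ∈ (C j).vertexSet) (hv : v ∈ (C 0).vertexSet) (huv : GT.Adj u v) :
    IsCutEdge GT s(u, v) := by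
  obtain ⟨parent, hpar, hTadj⟩ := hT
  have tree : ∀ {k l : Fin (m + 1)}, T.Adj (C k) (C l) →
      ∃ i, (k = parent i ∧ l = i.succ) ∨ (l = parent i ∧ k = i.succ) := by
    intro k l hkl
    obtain ⟨i, hi⟩ := (hTadj _ _).1 hkl
    rw [Sym2.eq_iff] at hi
    simp only [C.injective.eq_iff] at hi
    exact ⟨i, hi.imp id fun h => ⟨h.2, h.1⟩⟩
  have joined : ∀ {k l : Fin (m + 1)} {a b : V}, k ≠ l → a ∈ (C k).vertexSet →
      b ∈ (C l).vertexSet → GT.Adj a b → T.Adj (C k) (C l) := by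
    intro k l a b hkl ha hb hab
    by_contra hn
    exact hGT.adj_not_joined _ _ (fun h => hkl (C.injective h)) hn a ha b hb hab
  have hTj := joined hj hu hv huv
  obtain ⟨i, hi⟩ := tree hTj
  have hi' : parent i = 0 ∧ j = i.succ := by
    rcases hi with h | h
    · exact absurd h.2 (Fin.succ_ne_zero i).symm
    · exact ⟨h.1.symm, h.2⟩
  -- The descendants of `j` in the tree. A walk of the cycle-tree that avoids `uv` never leaves
  -- their cycles, whereas the root is no descendant.
  let Desc : Fin (m + 1) → Prop :=
    Relation.ReflTransGen (fun a b => ∃ i, a = parent i ∧ b = i.succ) j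
  have hDesc0 : ∀ k, Desc k → k ≠ 0 := by
    intro k hk
    cases hk with
    | refl => exact hj
    | tail _ h =>
      obtain ⟨i, -, rfl⟩ := h
      exact Fin.succ_ne_zero i
  refine ⟨huv, isBridge_iff.2 ?_⟩
  rintro ⟨w⟩
  suffices ∀ {a b : V} (w : (GT.spanningCoe.deleteEdges {s(u, v)}).Walk a b),
      (∃ k, Desc k ∧ a ∈ (C k).vertexSet) → ∃ k, Desc k ∧ b ∈ (C k).vertexSet by
    obtain ⟨k, hk, hvk⟩ := this w ⟨j, .refl, hu⟩
    exact hDesc0 k hk (C.injective (CycleOf.eq_of_mem hvk hv))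
  intro a b w
  induction w with
  | nil => exact id
  | @cons a b c hab _ ih =>
    rintro ⟨k, hk, hak⟩
    apply ih
    obtain ⟨hab, hne⟩ := deleteEdges_adj.1 hab
    rw [Subgraph.spanningCoe_adj] at hab
    have hbv : b ∈ (edgeInduced G E₂).verts := hGT.verts_eq ▸ GT.edge_vert hab.symm
    obtain ⟨l, hl⟩ := C.surjective ((edgeInduced G E₂).coe.connectedComponentMk ⟨b, hbv⟩)
    have hbl : b ∈ (C l).vertexSet := CycleOf.mem_vertexSet.2 ⟨hbv, hl.symm⟩
    by_cases hkl : k = l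
    · exact ⟨k, hk, hkl ▸ hbl⟩
    obtain ⟨i', h | h⟩ := tree (joined hkl hak hbl hab)
    · exact ⟨l, hk.tail ⟨i', h⟩, hbl⟩
    -- The walk moves up to a parent. From `j` itself this would use the only edge joining `C j` to
    -- the root, which is `uv`; from a proper descendant, uniqueness of parents keeps it below `j`.
    cases hk with
    | refl =>
      exfalso
      have hii : i' = i := Fin.succ_injective _ (h.2.symm.trans hi'.2)
      obtain rfl : l = 0 := by rw [h.1, hii, hi'.1]
      obtain ⟨p, -, hp⟩ := hGT.adj_joined _ _ hTj
      have := (hp (a, b) ⟨hak, hbl, hab⟩).trans (hp (u, v) ⟨hu, hv, huv⟩).symm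
      rw [Prod.mk.injEq] at this
      exact hne (by rw [this.1, this.2]; rfl)
    | tail hk' h' =>
      obtain ⟨i'', h1, h2⟩ := h'
      obtain rfl : i'' = i' := Fin.succ_injective _ (h2.symm.trans h.2)
      rw [← h1] at h
      exact ⟨l, h.1 ▸ hk', hbl⟩

/-- All cycles are connected to the root in a graph that contains the cycle-tree. -/
theorem reachable_of_cycleTree (hT : IsDFSTree (cycleGraph G E₂) T C)
    (hGT : IsCycleTreeWithStructure T GT) {H : SimpleGraph V}
    (hE : ∀ a b, (edgeInduced G E₂).Adj a b → H.Adj a b) (hH : ∀ a b, GT.Adj a b → H.Adj a b)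
    {v : V} (hv : v ∈ (C 0).vertexSet) (k : Fin (m + 1)) :
    ∀ u ∈ (C k).vertexSet, H.Reachable v u := by
  obtain ⟨parent, hpar, hTadj⟩ := hT
  induction k using WellFoundedLT.induction with
  | ind k ih =>
    intro u hu
    cases k using Fin.cases with
    | zero => exact CycleOf.reachable hE hv hu
    | succ i =>
      obtain ⟨⟨a, b⟩, ⟨ha, hb, hab⟩, -⟩ := hGT.adj_joined (C (parent i)) (C i.succ)
        ((hTadj _ _).2 ⟨i, rfl⟩)
      exact ((ih _ (hpar i).1 a ha).trans (hH _ _ hab).reachable).trans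
        (CycleOf.reachable hE hb hu)

end Decomposition

end IncidenceChoosability

namespace IncidenceChoosability

/-! ### Choosability and the three free edges -/

open SimpleGraph

theorem slackColorable_arcs_of_pendentEdge {V α : Type*} [Fintype V]
    [Nonempty α] {G : SimpleGraph V} (hconn : G.Connected)
    (hac : ∀ u v, (G.neighborSet u).ncard ≠ 3 → (G.neighborSet v).ncard ≠ 3 → u = v) {q : V}
    (hq : (G.neighborSet q).ncard = 1) {e : Sym2 V} (he : e ∈ G.edgeSet) (hqe : q ∈ e) :
    SlackColorable α (arcGraph V) (fun _ => 0) (arcs (G.deleteEdges {e})) := by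
  obtain ⟨x, rfl⟩ := hqe
  obtain ⟨y, hy⟩ := Set.ncard_eq_one.1 hq
  have hy' : ∀ z, G.Adj q z ↔ z = y := fun z => by
    rw [← mem_neighborSet, hy, Set.mem_singleton_iff]
  have hx : x = y := (hy' x).1 he
  subst hx
  refine slackColorable_arcs_deleteEdges_of_pendent hconn he (fun z => (hy' z).1) fun v hv => ?_
  by_contra hv3
  exact hv (hac v q hv3 (by omega))

theorem degree_eq_ncard {V : Type*} (G : SimpleGraph V) (v : V)
    [Fintype (G.neighborSet v)] : G.degree v = (G.neighborSet v).ncard := by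
  rw [Set.ncard_eq_toFinset_card', ← SimpleGraph.card_neighborFinset_eq_degree,
    SimpleGraph.neighborFinset]

/-- In the cubic case all vertices serve as `W`. Otherwise there is a vertex of degree one, and its
pendent edge is freely choosable, so any two distinct colors on it extend. -/
theorem isChoosable_of_oneTwoDecomposition {V α : Type*} [Fintype V]
    [Nonempty α] {G : SimpleGraph V} (hconn : G.Connected)
    (h13 : ∀ v, (G.neighborSet v).ncard = 3 ∨ (G.neighborSet v).ncard = 1)
    (hac : ∀ u v, (G.neighborSet u).ncard ≠ 3 → (G.neighborSet v).ncard ≠ 3 → u = v)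
    {L : Incidence G → Finset α} (hL : ∀ i, (L i).card = 6) : IsChoosable L := by
  have hdeg : ∀ v, (G.neighborSet v).ncard ≤ 3 := fun v => by have := h13 v; omega
  by_cases hcub : ∀ v, (G.neighborSet v).ncard = 3
  · obtain ⟨v⟩ := hconn.nonempty
    refine isChoosable_of_slackColorable hdeg hL (slackColorable_arcs (W := Set.univ) hdeg
      ⟨v, trivial⟩ (fun w _ => (hcub w).ge) (fun w _ p => ?_)
      fun w _ y _ _ => hconn.preconnected w y)
    obtain ⟨m, hm, hmp, -⟩ := exists_adj_ne_ne (hcub w).ge p p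
    exact ⟨m, trivial, hm, hmp⟩
  · push Not at hcub
    obtain ⟨q, hq3⟩ := hcub
    have hq : (G.neighborSet q).ncard = 1 := (h13 q).resolve_left hq3
    obtain ⟨x, hx⟩ := Set.ncard_eq_one.1 hq
    have hqx : G.Adj q x := by rw [← mem_neighborSet, hx]; rfl
    have hfree := isFreelyChoosable_of_slackColorable hdeg hL
      (slackColorable_arcs_of_pendentEdge (α := α) hconn hac hq
        (e := s(q, x)) hqx (Sym2.mem_mk_left _ _))
    let i : Incidence G := ⟨(q, s(q, x)), hqx, Sym2.mem_mk_left _ _⟩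
    let j : Incidence G := ⟨(x, s(q, x)), hqx, Sym2.mem_mk_right _ _⟩
    have hij : i ≠ j := fun h => hqx.ne (congrArg Incidence.vertex h)
    obtain ⟨c₁, hc₁⟩ : (L i).Nonempty := by rw [← Finset.card_pos, hL]; omega
    obtain ⟨c₂, hc₂, hc⟩ := Finset.exists_mem_ne (by rw [hL]; omega : 1 < (L j).card) c₁
    obtain ⟨φ, hφ, -⟩ := hfree i j hij rfl rfl c₁ hc₁ c₂ hc₂ hc.symm
    exact ⟨φ, hφ⟩

theorem reachable_deleteEdges_of_isCycleLabelling {V : Type*}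
    {G : SimpleGraph V} {E₂ : Set (Sym2 V)} {C : CycleOf G E₂} {n : ℕ} (hn : 3 ≤ n)
    {x : ZMod n → V} (hx : IsCycleLabelling C n x) :
    (G.deleteEdges {s(x 0, x 1)}).Reachable (x 0) (x 1) := by
  obtain ⟨hinj, -, hadj⟩ := hx
  have key : ∀ t : ℕ, t + 1 ≤ n →
      (G.deleteEdges {s(x 0, x 1)}).Reachable (x 1) (x ((t + 1 : ℕ) : ZMod n)) := by
    intro t
    induction t with
    | zero => intro _; simp
    | succ t ih =>
      intro ht
      refine (ih (by omega)).trans (Adj.reachable (deleteEdges_adj.2 ⟨?_, fun h => ?_⟩))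
      · have := (hadj ((t + 1 : ℕ) : ZMod n)).1
        rwa [← Nat.cast_succ] at this
      · rw [Set.mem_singleton_iff, Sym2.eq_iff] at h
        rcases h with h | h
        · have h0 := hinj h.1
          rw [ZMod.natCast_eq_zero_iff] at h0
          have := Nat.le_of_dvd (by omega) h0
          omega
        -- A reversed coincidence would make `n` divide both `t` and `t + 2`, hence 2.
        · have h0 := hinj h.2
          have h1 := hinj h.1
          rw [ZMod.natCast_eq_zero_iff] at h0
          have h1' : ((t : ℕ) : ZMod n) = 0 := by
            push_cast at h1
            simpa using h1
          rw [ZMod.natCast_eq_zero_iff] at h1'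
          have h2 := (Nat.dvd_add_right h1').1 (show n ∣ t + 2 from h0)
          have := Nat.le_of_dvd (by omega) h2
          omega
  have := key (n - 1) (by omega)
  rw [show n - 1 + 1 = n by omega, ZMod.natCast_self] at this
  exact this.symm

end IncidenceChoosability

theorem lemma4p1 {V α : Type*} [Fintype V] (G : SimpleGraph V) [DecidableRel G.Adj]
    (hconn : G.Connected) (hcubic : IncidenceChoosability.IsAlmostCubic G)
    (E₁ E₂ : Set (Sym2 V)) (hdec : IncidenceChoosability.IsOneTwoDecomposition G E₁ E₂)
    (L : IncidenceChoosability.Incidence G → Finset α) (hL : ∀ i, (L i).card = 6)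
    {m : ℕ} (C : Fin (m + 1) ≃ IncidenceChoosability.CycleOf G E₂)
    (T : SimpleGraph (IncidenceChoosability.CycleOf G E₂))
    (hT : IncidenceChoosability.IsDFSTree (IncidenceChoosability.cycleGraph G E₂) T C)
    (GT : G.Subgraph) (hGT : IncidenceChoosability.IsCycleTreeWithStructure T GT) :
    IncidenceChoosability.IsChoosable L ∧
    ∀ e ∈ G.edgeSet, (∃ v ∈ e, v ∈ (C 0).vertexSet) →
      ((∃ n : ℕ, 7 ≤ n ∧ ∃ x : ZMod n → V, IncidenceChoosability.IsCycleLabelling (C 0) n x ∧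
          e = s(x 0, x 1) ∧ G.Adj (x 2) (x 4) ∧ G.Adj (x 3) (x 5) ∧ G.Adj (x 1) (x 6)) ∨
        IncidenceChoosability.IsPendentEdge G e ∨
        (¬ IncidenceChoosability.IsCutEdge GT e ∧
          ∃ j : Fin (m + 1), j ≠ 0 ∧ IncidenceChoosability.IsPendentCycle GT (C j) ∧
            ∃ x : ZMod 6 → V, IncidenceChoosability.IsCycleLabelling (C j) 6 x ∧
              G.Adj (x 2) (x 4) ∧ G.Adj (x 3) (x 5) ∧ x 1 ∈ e)) →
      IncidenceChoosability.IsFreelyChoosable L e := by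
  open IncidenceChoosability SimpleGraph in
  · classical
    have h13 := fun v => hdec.ncard_neighborSet v
    have hac : ∀ u v, (G.neighborSet u).ncard ≠ 3 → (G.neighborSet v).ncard ≠ 3 → u = v := by
      intro u v hu hv
      rw [← degree_eq_ncard] at hu hv
      exact hcubic u v hu hv
    have hdeg : ∀ v, (G.neighborSet v).ncard ≤ 3 := fun v => by have := h13 v; omega
    have hne : Nonempty α := by
      obtain ⟨v⟩ := hconn.nonempty
      have : (G.neighborSet v).Nonempty := by
        rw [← Set.ncard_pos]
        have := h13 v
        omega
      obtain ⟨w, hw⟩ := this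
      let i : Incidence G := ⟨(v, s(v, w)), hw, Sym2.mem_mk_left _ _⟩
      have : (L i).Nonempty := by rw [← Finset.card_pos, hL]; omega
      exact ⟨this.choose⟩
    refine ⟨isChoosable_of_oneTwoDecomposition hconn h13 hac hL, ?_⟩
    rintro e he ⟨v, hve, hvC⟩ h
    apply isFreelyChoosable_of_slackColorable hdeg hL
    rcases h with ⟨n, hn, x, hx, rfl, h24, -, -⟩ | ⟨-, q, hqe, hq⟩ |
      ⟨hcut, j, hj, -, x, hx, h24, -, hxe⟩
    · have hnat : ∀ a b : ℕ, a < 7 → b < 7 → a ≠ b → x a ≠ x b := by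
        intro a b ha hb hab h
        have := hx.1 h
        rw [ZMod.natCast_eq_natCast_iff', Nat.mod_eq_of_lt (by omega),
          Nat.mod_eq_of_lt (by omega)] at this
        exact hab this
      have h23 := (hx.2.2 2).1
      have h34 := (hx.2.2 3).1
      rw [show (2 : ZMod n) + 1 = 3 by norm_num] at h23
      rw [show (3 : ZMod n) + 1 = 4 by norm_num] at h34
      -- The chord `x₂x₄` closes the triangle `x₂x₃x₄`, which avoids `x₀`; the rest of the cycle
      -- keeps the ends of the deleted edge connected.
      refine slackColorable_arcs_deleteEdges_of_triangle hconn
        (reachable_deleteEdges_of_isCycleLabelling (by omega) hx) h23 h34 h24 ?_ ?_ ?_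
      · simpa using hnat 0 2 (by omega) (by omega) (by omega)
      · simpa using hnat 0 3 (by omega) (by omega) (by omega)
      · simpa using hnat 0 4 (by omega) (by omega) (by omega)
    · rw [degree_eq_ncard] at hq
      exact slackColorable_arcs_of_pendentEdge hconn hac hq he hqe
    · have hxC : ∀ i, x i ∈ (C j).vertexSet := fun i => hx.2.1 ▸ Set.mem_range_self i
      have hdis : ∀ {u}, u ∈ (C j).vertexSet → u ∉ (C 0).vertexSet := fun h h' =>
        hj (C.injective (CycleOf.eq_of_mem h h'))
      have hvx : ∀ i, v ≠ x i := fun i h => hdis (hxC i) (h ▸ hvC)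
      obtain rfl : e = s(v, x 1) := (Sym2.mem_and_mem_iff (hvx 1)).1 ⟨hve, hxe⟩
      -- The edge joins the root to another cycle, so it would be a cut edge if it belonged to `GT`.
      -- Hence `GT` survives the deletion and still connects `v` to `x 1`.
      have hGTe : ∀ a b, GT.Adj a b → (G.deleteEdges {s(v, x 1)}).Adj a b := by
        refine fun a b hab => deleteEdges_adj.2 ⟨hab.adj_sub, fun h => hcut ?_⟩
        rw [Set.mem_singleton_iff] at h
        have : GT.Adj v (x 1) := by rwa [← Subgraph.mem_edgeSet, ← h]
        rw [Sym2.eq_swap]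
        exact isCutEdge_of_adj hT hGT hj (hxC 1) hvC this.symm
      have hE : ∀ a b, (edgeInduced G E₂).Adj a b → (G.deleteEdges {s(v, x 1)}).Adj a b := by
        refine fun a b hab => deleteEdges_adj.2 ⟨hab.adj_sub, fun h => ?_⟩
        rw [Set.mem_singleton_iff] at h
        have : (edgeInduced G E₂).Adj v (x 1) := by rwa [← Subgraph.mem_edgeSet, ← h]
        exact hdis (hxC 1) (CycleOf.mem_of_adj hvC this)
      exact slackColorable_arcs_deleteEdges_of_triangle hconn
        (reachable_of_cycleTree hT hGT hE hGTe hvC j _ (hxC 1))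
        (show G.Adj (x 2) (x 3) from (hx.2.2 2).1) (show G.Adj (x 3) (x 4) from (hx.2.2 3).1) h24
        (hvx 2) (hvx 3) (hvx 4)
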